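/- Let $(\mathsf Z,\mathcal Z)$ be a measurable space, $\pi$ a probability measure on it, $F:\mathbb R^d\times\mathsf Z\to\mathbb R$ measurable and $\pi$-integrable in $z$ and differentiable in $x$, and $f(x)=\mathbb E_{Z\sim\pi}[F(x,Z)]$. Write $\nabla F(x,z)$ for the gradient in $x$. Assume: 1. $f$ is $L$-smooth ($L>0$): $f$ is differentiable and $\|\nabla f(x)-\nabla f(y)\|\le L\|x-y\|$ for all $x,y$. 2. $f$ is $\mu$-strongly convex ($\mu>0$): $f$ is $C^1$ and $\frac{\mu}{2}\|x-y\|^2\le f(x)-f(y)-\langle\nabla f(y),x-y\rangle$ for all $x,y$. Let $x^*$ be its minimizer. 3. $(Z_i)_{i\ge0}$ is a stationary Markov chain with Markov kernel $\mathrm Q$ and unique invariant distribution $\pi$ (so $Z_0\sim\pi$), and $\mathrm Q$ is uniformly geometrically ergodic with mixing time $\tau\in\mathbb N$, $\tau\ge1$: for every $k\in\mathbb N$, $\sup_{z,z'}\frac12\|\mathrm Q^k(z,\cdot)-\mathrm Q^k(z',\cdot)\|_{\mathsf{TV}}\le(1/4)^{\lfloor k/\tau\rfloor}$. 4. For all $x$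 and $z$: $\mathbb E_\pi[\nabla F(x,Z)]=\nabla f(x)$ and $\|\nabla F(x,z)-\nabla f(x)\|^2\le\sigma^2+\delta^2\|\nabla f(x)\|^2$. Let $J_0,J_1,\dots$ be i.i.d. with $\mathbb P(J_k=j)=2^{-j}$, $j\ge1$, independent of $(Z_i)$. Given parameters $\gamma,p,\beta,\eta,\theta,M\in\mathbb R$, $B\in\mathbb N$ and a deterministic $x^0=x_f^0\in\mathbb R^d$, $T^0=0$, run for $k=0,1,2,\dots$ $$x_g^k=\theta x_f^k+(1-\theta)x^k,\qquad g_j^k=\frac1{2^jB}\sum_{i=1}^{2^jB}\nabla F(x_g^k,Z_{T^k+i}),$$ $$g^k=g_0^k+\begin{cases}2^{J_k}\,(g^k_{J_k}-g^k_{J_k-1}),&2^{J_k}\le M,\\0,&\text{otherwise,}\end{cases}$$ $$x_f^{k+1}=x_g^k-p\gamma g^k,\qquad x^{k+1}=\eta x_f^{k+1}+(p-\eta)x_f^k+(1-p)(1-\beta)x^k+(1-p)\beta x_g^k,\qquad T^{k+1}=T^k+2^{J_k}B.$$ Put $C_1=16(1+1/\ln^2 4)$ and $C_2=256/3$. There is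 an absolute constant $C>0$ such that, in every such setting, for every integer $b\ge1$, every $\gamma\in(0,\frac{3}{4L}]$, every $x^0\in\mathbb R^d$ and every $N\in\mathbb N$, with $$p=\Bigl[1+2(1+\gamma L)\bigl(1+4[C_1\tau b^{-1}+(C_1+1)\tau^2b^{-2}]\delta^2\bigr)\Bigr]^{-1},\quad \beta=\sqrt{\tfrac{4p^2\mu\gamma}{3}},\quad \eta=\sqrt{\tfrac{3}{\mu\gamma}},$$ $$\theta=\frac{p\eta^{-1}-1}{\beta p\eta^{-1}-1},\quad M=\max\bigl\{2,\sqrt{C_2p^{-1}(1+2p/\beta)}\bigr\},\quad B=\lceil b\log_2M\rceil,$$ the random variable below is integrable and $$\mathbb E\Bigl[\|x^N-x^*\|^2+\tfrac6\mu\bigl(f(x_f^N)-f(x^*)\bigr)\Bigr]\le C\Bigl\{\exp\Bigl(-N\sqrt{\tfrac{p^2\mu\gamma}{3}}\Bigr)\Bigl[\|x^0-x^*\|^2+\tfrac6\mu\bigl(f(x^0)-f(x^*)\bigr)\Bigr]+\frac{p\sqrt\gamma}{\mu^{3/2}}\,\sigma^2\Bigl(\frac{\tau}{b}+\frac{\tau^2}{b^2}\Bigr)\Bigr\}.$$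 -/

import Mathlib

open MeasureTheory ProbabilityTheory
open scoped ENNReal

noncomputable section

/-- `f` is differentiable and its gradient is `L`-Lipschitz, with `L > 0`. -/
structure IsLSmooth {d : ℕ} (f : EuclideanSpace ℝ (Fin d) → ℝ) (L : ℝ) : Prop where
  pos : 0 < L
  differentiable : Differentiable ℝ f
  lipschitz : ∀ x y, ‖gradient f x - gradient f y‖ ≤ L * ‖x - y‖

/-- `f` is continuously differentiable and `μ`-strongly convex, with `μ > 0`. -/
structure IsStronglyConvex {d : ℕ} (f : EuclideanSpace ℝ (Fin d) → ℝ) (μ : ℝ) : Prop where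
  pos : 0 < μ
  contDiff : ContDiff ℝ 1 f
  lower_bound : ∀ x y, μ / 2 * ‖x - y‖ ^ 2 ≤ f x - f y - inner ℝ (gradient f y) (x - y)

/-- The total variation norm `‖ν - ν'‖_TV` of the difference of two finite measures (total mass of
the variation of the signed measure `ν - ν'`; between two probability measures it is at most 2). -/
def tvNorm {S : Type*} [MeasurableSpace S] (ν ν' : Measure S) [IsFiniteMeasure ν]
    [IsFiniteMeasure ν'] : ℝ≥0∞ :=
  (ν.toSignedMeasure - ν'.toSignedMeasure).totalVariation Set.univ

/-- The Dobrushin coefficient `sup_{z, z'} (1/2) ‖Q(z, ·) - Q(z', ·)‖_TV` of a kernel. -/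
def dobrushin {S : Type*} [MeasurableSpace S] (Q : Kernel S S) [IsMarkovKernel Q] : ℝ≥0∞ :=
  ⨆ (z : S) (z' : S), 2⁻¹ * tvNorm (Q z) (Q z')

instance isMarkovKernel_pow {S : Type*} [MeasurableSpace S] (Q : Kernel S S) [IsMarkovKernel Q]
    (k : ℕ) : IsMarkovKernel (Q ^ k) := by
  induction k with
  | zero => rw [pow_zero]; exact inferInstanceAs (IsMarkovKernel Kernel.id)
  | succ k ih => rw [pow_succ]; exact inferInstanceAs (IsMarkovKernel ((Q ^ k) ∘ₖ Q))

/-- `Q` has the unique invariant distribution `π`, and it is uniformly geometrically ergodic with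
mixing time `τ ≥ 1`. -/
structure IsUniformlyGeometricallyErgodic {S : Type*} [MeasurableSpace S] (Q : Kernel S S)
    [IsMarkovKernel Q] (π : Measure S) (τ : ℕ) : Prop where
  isProbabilityMeasure : IsProbabilityMeasure π
  invariant : Q.Invariant π
  unique : ∀ π' : Measure S, IsProbabilityMeasure π' → Q.Invariant π' → π' = π
  mixing_time_pos : 0 < τ
  dobrushin_le : ∀ k : ℕ, dobrushin (Q ^ k) ≤ (1 / 4) ^ (k / τ)

/-- `Z` is a Markov chain with transition kernel `Q` and initial distribution `π` on the
probability space `(Ω, P)`: given `Z_0, …, Z_n`, the variable `Z_{n+1}` has the conditional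
distribution `Q(Z_n, ·)`. -/
structure IsMarkovChain {S Ω : Type*} [MeasurableSpace S] [MeasurableSpace Ω] (Z : ℕ → Ω → S)
    (Q : Kernel S S) (π : Measure S) (P : Measure Ω) : Prop where
  measurable : ∀ n, Measurable (Z n)
  initial : P.map (Z 0) = π
  transition : ∀ n : ℕ, HasCondDistrib (Z (n + 1)) (fun ω (i : Finset.Iic n) => Z i ω)
    (Q.comap (fun h : Finset.Iic n → S => h ⟨n, Finset.mem_Iic.2 le_rfl⟩)
      (measurable_pi_apply _)) P

/-- `J_0, J_1, …` are i.i.d. with `ℙ(J_k = j) = 2^{-j}` for `j = 1, 2, …`. -/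
structure IsIIDGeometricHalf {Ω : Type*} [MeasurableSpace Ω] (J : ℕ → Ω → ℕ)
    (P : Measure Ω) : Prop where
  measurable : ∀ k, Measurable (J k)
  independent : iIndepFun J P
  law : ∀ k j : ℕ, 1 ≤ j → P {ω | J k ω = j} = (1 / 2) ^ j

/-- The stochastic gradient `∇F(x, z)`, the gradient being taken in `x`. -/
def stochGrad {d : ℕ} {S : Type*} (F : EuclideanSpace ℝ (Fin d) → S → ℝ)
    (x : EuclideanSpace ℝ (Fin d)) (z : S) : EuclideanSpace ℝ (Fin d) :=
  gradient (fun y => F y z) x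

/-- The batch average `g_j = 2^{-j} B^{-1} ∑_{i=1}^{2^j B} ∇F(x, z_{T+i})`. -/
def batchGrad {d : ℕ} {S : Type*} (F : EuclideanSpace ℝ (Fin d) → S → ℝ) (z : ℕ → S)
    (B T j : ℕ) (x : EuclideanSpace ℝ (Fin d)) : EuclideanSpace ℝ (Fin d) :=
  ((2 : ℝ) ^ j * (B : ℝ))⁻¹ • ∑ i ∈ Finset.Icc 1 (2 ^ j * B), stochGrad F x (z (T + i))

open Classical in
/-- The randomized-batch estimate `g_0 + 2^j (g_j - g_{j-1})` if `2^j ≤ M`, and `g_0` otherwise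
(it is used for `j ≥ 1`; the value `j = 0` has probability zero in the algorithm). -/
def mlmcGrad {d : ℕ} {S : Type*} (F : EuclideanSpace ℝ (Fin d) → S → ℝ) (z : ℕ → S)
    (M : ℝ) (B T j : ℕ) (x : EuclideanSpace ℝ (Fin d)) : EuclideanSpace ℝ (Fin d) :=
  batchGrad F z B T 0 x +
    if (2 : ℝ) ^ j ≤ M then
      (2 : ℝ) ^ j • (batchGrad F z B T j x - batchGrad F z B T (j - 1) x)
    else 0

/-- State of the accelerated method: the points `x^k`, `x_f^k` and the sample counter `T^k`. -/
structure AccState (d : ℕ) where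
  x : EuclideanSpace ℝ (Fin d)
  xf : EuclideanSpace ℝ (Fin d)
  T : ℕ

/-- One iteration of the method with level `j = J_k` along the noise trajectory `z`. -/
def accStep {d : ℕ} {S : Type*} (F : EuclideanSpace ℝ (Fin d) → S → ℝ) (γ p β η θ M : ℝ) (B : ℕ)
    (z : ℕ → S) (j : ℕ) (s : AccState d) : AccState d :=
  let xg := θ • s.xf + (1 - θ) • s.x
  let xf' := xg - (p * γ) • mlmcGrad F z M B s.T j xg
  { x := η • xf' + (p - η) • s.xf + ((1 - p) * (1 - β)) • s.x + ((1 - p) * β) • xg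
    xf := xf'
    T := s.T + 2 ^ j * B }

/-- The state after `k` iterations started from `x^0 = x_f^0 = x₀`, `T^0 = 0`, along the noise
trajectory `z` with levels `J_0, J_1, … = j 0, j 1, …`. -/
def accIterate {d : ℕ} {S : Type*} (F : EuclideanSpace ℝ (Fin d) → S → ℝ) (γ p β η θ M : ℝ)
    (B : ℕ) (x₀ : EuclideanSpace ℝ (Fin d)) (z : ℕ → S) (j : ℕ → ℕ) : ℕ → AccState d
  | 0 => { x := x₀, xf := x₀, T := 0 }
  | k + 1 => accStep F γ p β η θ M B z (j k) (accIterate F γ p β η θ M B x₀ z j k)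

/-- The numerical constant `C₁ = 16 (1 + 1 / ln² 4)`. -/
def constC1 : ℝ := 16 * (1 + 1 / Real.log 4 ^ 2)

/-- The numerical constant `C₂ = 256 / 3`. -/
def constC2 : ℝ := 256 / 3

end

/-! The mean of the potential ‖x - x*‖² + (6/μ)(f(x_f) - f(x*)) contracts by 1 - β/2 per iteration,
up to an additive noise term. Since β/2 = √(p²μγ/3), iterating gives the exponential rate and
divides the noise term by β/2.

Deterministic part (`IsAccParam.potential_step_le`). The parameters satisfy η = 2p/β and p²γ =
3β²/(4μ), and θ is such that x⁺ = y - (3β/2μ) g with y = (1-β)x + βx_g = x_g + (2/β - 1)(x_g - x_f).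
Expanding the square, with strong convexity between x_g and x* and convexity between x_g and x_f,
gives the contraction. The gradient error e = g - ∇f(x_g) enters only through ‖e‖² and ⟨W, e⟩, where
W is a function of the current state. So only the mean square and the bias of g matter.

Stochastic part. Given the past, the noise i steps ahead is centred up to 2·4^(-⌊i/τ⌋), so a sum of
n noises has bias O(τ) and second moment O(τn). In the randomized estimator the probability 2^(-m)
cancels the factor 2^m: the biases telescope to that of the largest batch, of size 2^K B with K =
⌊log₂ M⌋, while each level adds O(τ/B) to the mean square. The resulting factor K is absorbed by B ≥
b log₂ M. The size of M makes the squared bias small against the weight 4 + 2p/β produced by Young's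
inequality, and the size of p lets the δ² terms be absorbed by the available -‖∇f(x_g)‖²
(`contraction_of_bounds`, `parameter_bounds`).

The sampling times T^k are random, but the levels are independent of the chain. Once they are
frozen, T^k is a number and the state is a function of the noise up to T^k, so the Markov property
is needed only at deterministic times. The truncation 2^J ≤ M keeps each iterate uniformly bounded,
which settles integrability. -/

/-! ### Total variation and geometric mixing -/

theorem abs_integral_le_of_abs_le {S : Type*} [MeasurableSpace S] (m : Measure S)
    [IsFiniteMeasure m] {φ : S → ℝ} {c : ℝ} (hc : ∀ s, |φ s| ≤ c) :
    |∫ s, φ s ∂m| ≤ c * m.real Set.univ :=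
  norm_integral_le_of_norm_le_const (f := φ) (Filter.Eventually.of_forall hc)

/-- The integrals of a bounded function against two finite measures differ by at most the total
variation norm of the difference times the bound. -/
theorem abs_integral_sub_integral_le_tvNorm {S : Type*} [MeasurableSpace S] (ν ν' : Measure S)
    [IsFiniteMeasure ν] [IsFiniteMeasure ν'] {φ : S → ℝ} (hφ : Measurable φ) {c : ℝ}
    (hc : ∀ s, |φ s| ≤ c) :
    |∫ s, φ s ∂ν - ∫ s, φ s ∂ν'| ≤ c * (tvNorm ν ν').toReal := by
  set s := ν.toSignedMeasure - ν'.toSignedMeasure with hs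
  set jd := s.toJordanDecomposition with hjd
  have hint : ∀ (m : Measure S) [IsFiniteMeasure m], Integrable φ m := fun m _ =>
    Integrable.of_bound hφ.aestronglyMeasurable c (Filter.Eventually.of_forall hc)
  -- Written without subtraction, the Jordan decomposition is an identity between positive measures
  -- and can be integrated term by term.
  have hsum : ν + jd.negPart = ν' + jd.posPart := by
    have h1 : jd.posPart.toSignedMeasure - jd.negPart.toSignedMeasure
        = ν.toSignedMeasure - ν'.toSignedMeasure := s.toSignedMeasure_toJordanDecomposition
    have h2 : (ν + jd.negPart).toSignedMeasure = (ν' + jd.posPart).toSignedMeasure := by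
      rw [Measure.toSignedMeasure_add, Measure.toSignedMeasure_add]
      rw [sub_eq_sub_iff_add_eq_add] at h1
      rw [← h1, add_comm]
    exact Measure.toSignedMeasure_eq_toSignedMeasure_iff.1 h2
  have h3 : ∫ s, φ s ∂ν + ∫ s, φ s ∂jd.negPart = ∫ s, φ s ∂ν' + ∫ s, φ s ∂jd.posPart := by
    rw [← integral_add_measure (hint _) (hint _), ← integral_add_measure (hint _) (hint _), hsum]
  have h4 : (tvNorm ν ν').toReal = jd.posPart.real Set.univ + jd.negPart.real Set.univ := by
    rw [tvNorm, ← hs, SignedMeasure.totalVariation, Measure.add_apply,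
      ENNReal.toReal_add (measure_ne_top _ _) (measure_ne_top _ _)]
    rfl
  have h5 := abs_le.1 (abs_integral_le_of_abs_le jd.posPart hc)
  have h6 := abs_le.1 (abs_integral_le_of_abs_le jd.negPart hc)
  rw [h4, abs_le]
  constructor <;> linarith

theorem Kernel.Invariant.pow {S : Type*} [MeasurableSpace S] {Q : Kernel S S} [IsMarkovKernel Q]
    {π : Measure S} (hQ : Q.Invariant π) (k : ℕ) : (Q ^ k).Invariant π := by
  induction k with
  | zero => rw [pow_zero]; exact Measure.id_comp
  | succ k ih => rw [pow_succ]; exact Kernel.Invariant.comp ih hQ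

/-- Geometric mixing: the `k`-step expectation of a bounded function is close to its stationary
expectation. -/
theorem IsUniformlyGeometricallyErgodic.abs_integral_pow_sub_le {S : Type*} [MeasurableSpace S]
    {Q : Kernel S S} [IsMarkovKernel Q] {π : Measure S} {τ : ℕ}
    (hQ : IsUniformlyGeometricallyErgodic Q π τ) {φ : S → ℝ} (hφ : Measurable φ) {c : ℝ}
    (hc : ∀ s, |φ s| ≤ c) (k : ℕ) (z : S) :
    |∫ s, φ s ∂((Q ^ k) z) - ∫ s, φ s ∂π| ≤ 2 * (1 / 4) ^ (k / τ) * c := by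
  have := hQ.isProbabilityMeasure
  have hc0 : 0 ≤ c := (abs_nonneg _).trans (hc z)
  have htv : ∀ z', (tvNorm ((Q ^ k) z) ((Q ^ k) z')).toReal ≤ 2 * (1 / 4) ^ (k / τ) := by
    intro z'
    have h1 : 2⁻¹ * tvNorm ((Q ^ k) z) ((Q ^ k) z') ≤ (1 / 4 : ℝ≥0∞) ^ (k / τ) :=
      le_trans (le_iSup₂ (f := fun z z' => 2⁻¹ * tvNorm ((Q ^ k) z) ((Q ^ k) z')) z z')
        (hQ.dobrushin_le k)
    have h2 := ENNReal.toReal_mono (by simp) h1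
    rw [ENNReal.toReal_mul, ENNReal.toReal_pow] at h2
    simp only [ENNReal.toReal_inv, ENNReal.toReal_ofNat, ENNReal.toReal_div,
      ENNReal.toReal_one] at h2
    linarith
  have hb : ∀ z', |∫ s, φ s ∂((Q ^ k) z)  - ∫ s, φ s ∂((Q ^ k) z')| ≤ 2 * (1 / 4) ^ (k / τ) * c := by
    intro z'
    refine (abs_integral_sub_integral_le_tvNorm _ _ hφ hc).trans ?_
    rw [mul_comm]
    exact mul_le_mul_of_nonneg_right (htv z') hc0
  -- By invariance the stationary mean is a π-average over starting points z', so the bound uniform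
  -- in pairs of starting points passes to π.
  have hinv : ∫ s, φ s ∂π = ∫ z', ∫ s, φ s ∂((Q ^ k) z') ∂π := by
    have h1 : ((Q ^ k) ∘ₖ Kernel.const S π) z = π := by
      rw [(Kernel.Invariant.pow hQ.invariant k).comp_const, Kernel.const_apply]
    conv_lhs => rw [← h1]
    rw [Kernel.integral_comp (Integrable.of_bound hφ.aestronglyMeasurable c
      (Filter.Eventually.of_forall hc)), Kernel.const_apply]
  have hm : StronglyMeasurable fun z' => ∫ s, φ s ∂((Q ^ k) z') :=
    hφ.stronglyMeasurable.integral_kernel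
  have hi : Integrable (fun z' => ∫ s, φ s ∂((Q ^ k) z')) π := by
    refine Integrable.of_bound hm.aestronglyMeasurable c (Filter.Eventually.of_forall fun z' => ?_)
    refine (abs_integral_le_of_abs_le _ hc).trans ?_
    simp
  have h7 : ∫ s, φ s ∂((Q ^ k) z) - ∫ s, φ s ∂π
      = ∫ z', (∫ s, φ s ∂((Q ^ k) z) - ∫ s, φ s ∂((Q ^ k) z')) ∂π := by
    rw [integral_sub (integrable_const _) hi, hinv]; simp
  rw [h7]
  refine (abs_integral_le_of_abs_le _ hb).trans ?_
  simp

/-! ### Markov property on path space -/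

/-- The law on path space of a sequence of random variables. -/
noncomputable def pathLaw {S Ω : Type*} [MeasurableSpace S] [MeasurableSpace Ω] (Z : ℕ → Ω → S)
    (P : Measure Ω) : Measure (ℕ → S) :=
  P.map fun ω n => Z n ω

/-- `DependsOn` plays the role of measurability with respect to the past: `G` factors through the
first T + 1 coordinates, and there the conditional law of the next state applies. -/
theorem IsMarkovChain.integral_step {S Ω : Type*} [MeasurableSpace S] [MeasurableSpace Ω]
    {Z : ℕ → Ω → S} {Q : Kernel S S} [IsMarkovKernel Q] {π : Measure S} {P : Measure Ω}
    [IsProbabilityMeasure P] (hZ : IsMarkovChain Z Q π P) {G : (ℕ → S) → S → ℝ}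
    (hG : Measurable (Function.uncurry G)) {c : ℝ} (hc : ∀ z s, |G z s| ≤ c) {T : ℕ}
    (hT : DependsOn G (Set.Iic T)) :
    ∫ z, G z (z (T + 1)) ∂(pathLaw Z P) = ∫ z, ∫ s, G z s ∂(Q (z T)) ∂(pathLaw Z P) := by
  have hZm : Measurable fun ω n => Z n ω := measurable_pi_lambda _ hZ.measurable
  -- A finite history becomes a path by freezing it after time `T`; `G` does not see the later
  -- values.
  let ext : (Finset.Iic T → S) → (ℕ → S) :=
    fun h n => h ⟨min n T, Finset.mem_Iic.2 (min_le_right _ _)⟩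
  have hext : Measurable ext := measurable_pi_lambda _ fun n => measurable_pi_apply _
  have hGe : ∀ ω, G (fun n => Z n ω) = G (ext fun i => Z i ω) := fun ω => hT fun i hi => by
    simp only [ext]; rw [min_eq_left hi]
  have hH : Measurable fun ω (i : Finset.Iic T) => Z i ω :=
    measurable_pi_lambda _ fun i => hZ.measurable i
  have hmap := (hZ.transition T).map_eq
  have hG' : Measurable fun q : (Finset.Iic T → S) × S => G (ext q.1) q.2 :=
    hG.comp ((hext.comp measurable_fst).prodMk measurable_snd)
  have hm1 : Measurable fun z : ℕ → S => G z (z (T + 1)) :=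
    hG.comp (measurable_id.prodMk (measurable_pi_apply _))
  have hm2 : StronglyMeasurable fun z : ℕ → S => ∫ s, G z s ∂(Q (z T)) := by
    have := StronglyMeasurable.integral_kernel_prod_right (κ := Q.comap (fun z : ℕ → S => z T)
      (measurable_pi_apply _)) hG.stronglyMeasurable
    simpa using this
  rw [pathLaw, integral_map hZm.aemeasurable hm1.aestronglyMeasurable,
    integral_map hZm.aemeasurable hm2.aestronglyMeasurable]
  simp only [hGe]
  have h1 : ∫ ω, G (ext fun i => Z i ω) (Z (T + 1) ω) ∂P
      = ∫ q, G (ext q.1) q.2 ∂(P.map fun ω => ((fun i : Finset.Iic T => Z i ω), Z (T + 1) ω)) := by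
    rw [integral_map (hH.prodMk (hZ.measurable _)).aemeasurable hG'.aestronglyMeasurable]
  rw [h1, hmap]
  have := Measure.isProbabilityMeasure_map (μ := P) hH.aemeasurable
  rw [Measure.integral_compProd (Integrable.of_bound hG'.aestronglyMeasurable c
    (Filter.Eventually.of_forall fun q => hc _ _))]
  rw [integral_map hH.aemeasurable]
  · rfl
  · exact (StronglyMeasurable.integral_kernel_prod_right hG'.stronglyMeasurable).aestronglyMeasurable

/-- The Markov property over `i` steps. -/
theorem IsMarkovChain.integral_steps {S Ω : Type*} [MeasurableSpace S] [MeasurableSpace Ω]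
    {Z : ℕ → Ω → S} {Q : Kernel S S} [IsMarkovKernel Q] {π : Measure S} {P : Measure Ω}
    [IsProbabilityMeasure P] (hZ : IsMarkovChain Z Q π P) {T : ℕ} (i : ℕ) {G : (ℕ → S) → S → ℝ}
    (hG : Measurable (Function.uncurry G)) {c : ℝ} (hc : ∀ z s, |G z s| ≤ c)
    (hT : DependsOn G (Set.Iic T)) :
    ∫ z, G z (z (T + i)) ∂(pathLaw Z P) = ∫ z, ∫ s, G z s ∂((Q ^ i) (z T)) ∂(pathLaw Z P) := by
  induction i generalizing G with
  | zero =>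
    congr 1 with z
    rw [pow_zero]
    change _ = ∫ s, G z s ∂(Kernel.id (z T))
    rw [Kernel.id_apply, integral_dirac' _ _ (hG.of_uncurry_left).stronglyMeasurable]
    rfl
  | succ i ih =>
    -- The last transition is integrated out first. Averaging `G` under `Q` keeps its dependence on
    -- the past within times up to `T`, so the induction hypothesis applies to the average.
    rw [← add_assoc, hZ.integral_step hG hc
      (hT.mono (Set.Iic_subset_Iic.2 (Nat.le_add_right T i)))]
    have hG' : Measurable (Function.uncurry fun (z : ℕ → S) (s : S) => ∫ s', G z s' ∂(Q s)) := by
      have h1 : Measurable fun q : ((ℕ → S) × S) × S => G q.1.1 q.2 :=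
        hG.comp ((measurable_fst.comp measurable_fst).prodMk measurable_snd)
      have := StronglyMeasurable.integral_kernel_prod_right
        (κ := Q.comap (fun q : (ℕ → S) × S => q.2) measurable_snd)
        (f := fun q s => G q.1 s) h1.stronglyMeasurable
      exact this.measurable
    have hc' : ∀ (z : ℕ → S) (s : S), |∫ s', G z s' ∂(Q s)| ≤ c := fun z s => by
      refine (abs_integral_le_of_abs_le _ (hc z)).trans ?_
      simp
    have hT' : DependsOn (fun (z : ℕ → S) (s : S) => ∫ s', G z s' ∂(Q s)) (Set.Iic T) :=
      fun z z' h => by simp only [hT h]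
    rw [ih hG' hc' hT']
    congr 1 with z
    rw [pow_succ']
    change _ = ∫ s, G z s ∂((Q ∘ₖ (Q ^ i)) (z T))
    rw [Kernel.integral_comp]
    exact Integrable.of_bound (hG.of_uncurry_left).aestronglyMeasurable c
      (Filter.Eventually.of_forall (hc z))

/-- The exponent is constant on blocks of τ indices, leaving τ times a geometric series of ratio
1/4. -/
theorem sum_range_pow_div_le (τ : ℕ) (hτ : 0 < τ) (n : ℕ) :
    ∑ i ∈ Finset.range n, (1 / 4 : ℝ) ^ (i / τ) ≤ 4 / 3 * τ := by
  have h : ∀ q : ℕ, ∑ i ∈ Finset.range (τ * q), (1 / 4 : ℝ) ^ (i / τ)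
      = 4 / 3 * τ * (1 - (1 / 4) ^ q) := by
    intro q
    induction q with
    | zero => simp
    | succ q ih =>
      rw [mul_add, mul_one, Finset.sum_range_add, ih]
      have : ∀ i ∈ Finset.range τ, (1 / 4 : ℝ) ^ ((τ * q + i) / τ) = (1 / 4) ^ q := by
        intro i hi
        rw [Nat.mul_add_div hτ, Nat.div_eq_of_lt (Finset.mem_range.1 hi), add_zero]
      rw [Finset.sum_congr rfl this]
      simp only [Finset.sum_const, Finset.card_range, nsmul_eq_mul, pow_succ]
      ring
  calc _ ≤ ∑ i ∈ Finset.range (τ * n), (1 / 4 : ℝ) ^ (i / τ) := by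
        refine Finset.sum_le_sum_of_subset_of_nonneg ?_ (fun _ _ _ => by positivity)
        exact Finset.range_mono (Nat.le_mul_of_pos_left n hτ)
    _ ≤ _ := by
        rw [h]
        have : (0 : ℝ) ≤ 4 / 3 * τ * (1 / 4) ^ n := by positivity
        linarith

/-- Omitting lag zero saves 1, which later pays for the diagonal terms of the second moment. -/
theorem sum_range_pow_succ_div_le (τ : ℕ) (hτ : 0 < τ) (n : ℕ) :
    ∑ i ∈ Finset.range n, (1 / 4 : ℝ) ^ ((i + 1) / τ) ≤ 4 / 3 * τ - 1 := by
  have := sum_range_pow_div_le τ hτ (n + 1)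
  rw [Finset.sum_range_succ'] at this
  simp only [Nat.zero_div, pow_zero] at this
  linarith

theorem IsMarkovChain.isProbabilityMeasure_pathLaw {S Ω : Type*} [MeasurableSpace S]
    [MeasurableSpace Ω] {Z : ℕ → Ω → S} {Q : Kernel S S} {π : Measure S} {P : Measure Ω}
    [IsProbabilityMeasure P] (hZ : IsMarkovChain Z Q π P) :
    IsProbabilityMeasure (pathLaw Z P) :=
  Measure.isProbabilityMeasure_map (measurable_pi_lambda _ hZ.measurable).aemeasurable

/-! ### Bias and second moment of sums of Markovian noise -/

section Noise

variable {S Ω E : Type*} [MeasurableSpace S] [MeasurableSpace Ω] {Z : ℕ → Ω → S} {Q : Kernel S S}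
  [IsMarkovKernel Q] {π : Measure S} {P : Measure Ω} [IsProbabilityMeasure P] {τ : ℕ}
  [NormedAddCommGroup E] [InnerProductSpace ℝ E] [CompleteSpace E] [MeasurableSpace E]
  [BorelSpace E] [SecondCountableTopology E]

/-- Correlation between the past up to time `T` and a centred noise at time `T + i`. -/
theorem IsMarkovChain.integral_inner_noise_le (hZ : IsMarkovChain Z Q π P)
    (hQ : IsUniformlyGeometricallyErgodic Q π τ) {T : ℕ} (i : ℕ) {U : (ℕ → S) → E}
    (hUm : Measurable U) {cU : ℝ} (hU : ∀ z, ‖U z‖ ≤ cU) (hUT : DependsOn U (Set.Iic T))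
    {H : (ℕ → S) → S → E} (hHm : Measurable (Function.uncurry H)) (hHT : DependsOn H (Set.Iic T))
    {R : (ℕ → S) → ℝ} (hRm : Measurable R) {cR : ℝ} (hR : ∀ z, R z ≤ cR)
    (hHR : ∀ z s, ‖H z s‖ ≤ R z) (hH0 : ∀ z, ∫ s, H z s ∂π = 0) :
    ∫ z, inner ℝ (U z) (H z (z (T + i))) ∂(pathLaw Z P)
      ≤ 2 * (1 / 4) ^ (i / τ) * ∫ z, ‖U z‖ * R z ∂(pathLaw Z P) := by
  have := hZ.isProbabilityMeasure_pathLaw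
  have := hQ.isProbabilityMeasure
  have hG : Measurable (Function.uncurry fun (z : ℕ → S) s => inner ℝ (U z) (H z s)) :=
    (hUm.comp measurable_fst).inner hHm
  have hR0 : ∀ z s, 0 ≤ R z := fun z s => (norm_nonneg _).trans (hHR z s)
  have hb : ∀ z s, |inner ℝ (U z) (H z s)| ≤ ‖U z‖ * R z := fun z s =>
    (abs_real_inner_le_norm _ _).trans (mul_le_mul_of_nonneg_left (hHR z s) (norm_nonneg _))
  have hb' : ∀ (z : ℕ → S), ‖U z‖ * R z ≤ cU * cR := fun z =>
    mul_le_mul (hU z) (hR z) (hR0 z (z 0)) ((norm_nonneg _).trans (hU z))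
  have hc : ∀ z s, |inner ℝ (U z) (H z s)| ≤ cU * cR := fun z s => (hb z s).trans (hb' z)
  have hT : DependsOn (fun (z : ℕ → S) s => inner ℝ (U z) (H z s)) (Set.Iic T) :=
    fun z z' h => by simp only [hUT h, hHT h]
  rw [hZ.integral_steps i hG hc hT, ← integral_const_mul]
  have hHi : ∀ z, Integrable (H z) π := fun z =>
    Integrable.of_bound (hHm.of_uncurry_left).aestronglyMeasurable _
      (Filter.Eventually.of_forall (hHR z))
  refine integral_mono ?_ ?_ fun z => ?_
  · have hm := StronglyMeasurable.integral_kernel_prod_right (κ := (Q ^ i).comap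
      (fun z : ℕ → S => z T) (measurable_pi_apply _)) hG.stronglyMeasurable
    refine Integrable.of_bound hm.aestronglyMeasurable (cU * cR)
      (Filter.Eventually.of_forall fun z => ?_)
    refine (abs_integral_le_of_abs_le _ (hc z)).trans ?_
    simp
  · refine Integrable.const_mul ?_ _
    refine Integrable.of_bound (hUm.norm.mul hRm).aestronglyMeasurable (cU * cR)
      (Filter.Eventually.of_forall fun z => ?_)
    rw [Real.norm_of_nonneg (mul_nonneg (norm_nonneg _) (hR0 z (z 0)))]
    exact hb' z
  -- Mixing is applied with the past fixed, so its constant is the local ‖U z‖ R z and not the crude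
  -- uniform bound, which serves integrability only.
  · have h1 := hQ.abs_integral_pow_sub_le (hG.of_uncurry_left (x := z)) (hb z) i (z T)
    have h2 : ∫ s, inner ℝ (U z) (H z s) ∂π = 0 := by
      rw [integral_inner (hHi z), hH0, inner_zero_right]
    rw [h2, sub_zero] at h1
    exact (le_abs_self _).trans h1

/-- Bias of a sum of centred noises, tested against the past. -/
theorem IsMarkovChain.integral_inner_sum_noise_le (hZ : IsMarkovChain Z Q π P)
    (hQ : IsUniformlyGeometricallyErgodic Q π τ) {T : ℕ} (n : ℕ) {U : (ℕ → S) → E}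
    (hUm : Measurable U) {cU : ℝ} (hU : ∀ z, ‖U z‖ ≤ cU) (hUT : DependsOn U (Set.Iic T))
    {H : (ℕ → S) → S → E} (hHm : Measurable (Function.uncurry H)) (hHT : DependsOn H (Set.Iic T))
    {R : (ℕ → S) → ℝ} (hRm : Measurable R) {cR : ℝ} (hR : ∀ z, R z ≤ cR)
    (hHR : ∀ z s, ‖H z s‖ ≤ R z) (hH0 : ∀ z, ∫ s, H z s ∂π = 0) :
    ∫ z, inner ℝ (U z) (∑ i ∈ Finset.range n, H z (z (T + (i + 1)))) ∂(pathLaw Z P)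
      ≤ 8 / 3 * τ * ∫ z, ‖U z‖ * R z ∂(pathLaw Z P) := by
  have := hZ.isProbabilityMeasure_pathLaw
  have hR0 : ∀ z : ℕ → S, 0 ≤ R z := fun z => (norm_nonneg _).trans (hHR z (z 0))
  have hm : ∀ i, Measurable fun z : ℕ → S => inner ℝ (U z) (H z (z (T + (i + 1)))) := fun i =>
    hUm.inner (hHm.comp (measurable_id.prodMk (measurable_pi_apply _)))
  have hi : ∀ i, Integrable (fun z : ℕ → S => inner ℝ (U z) (H z (z (T + (i + 1)))))
      (pathLaw Z P) := fun i => by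
    refine Integrable.of_bound (hm i).aestronglyMeasurable (cU * cR)
      (Filter.Eventually.of_forall fun z => ?_)
    refine (abs_real_inner_le_norm _ _).trans ?_
    exact mul_le_mul (hU z) ((hHR _ _).trans (hR z)) (norm_nonneg _) ((norm_nonneg _).trans (hU z))
  simp only [inner_sum]
  rw [integral_finsetSum _ fun i _ => hi i]
  have hI : 0 ≤ ∫ z, ‖U z‖ * R z ∂(pathLaw Z P) :=
    integral_nonneg fun z => mul_nonneg (norm_nonneg _) (hR0 z)
  calc _ ≤ ∑ i ∈ Finset.range n, 2 * (1 / 4) ^ ((i + 1) / τ) * ∫ z, ‖U z‖ * R z ∂(pathLaw Z P) :=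
        Finset.sum_le_sum fun i _ =>
          hZ.integral_inner_noise_le hQ (i + 1) hUm hU hUT hHm hHT hRm hR hHR hH0
    _ = (2 * ∑ i ∈ Finset.range n, (1 / 4 : ℝ) ^ ((i + 1) / τ))
          * ∫ z, ‖U z‖ * R z ∂(pathLaw Z P) := by rw [Finset.mul_sum, Finset.sum_mul]
    _ ≤ _ := mul_le_mul_of_nonneg_right
        (by linarith [sum_range_pow_succ_div_le τ hQ.mixing_time_pos n]) hI

/-- Second moment of a sum of centred noises. -/
theorem IsMarkovChain.integral_norm_sq_sum_noise_le (hZ : IsMarkovChain Z Q π P)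
    (hQ : IsUniformlyGeometricallyErgodic Q π τ) {T : ℕ} (n : ℕ)
    {H : (ℕ → S) → S → E} (hHm : Measurable (Function.uncurry H)) (hHT : DependsOn H (Set.Iic T))
    {R : (ℕ → S) → ℝ} (hRm : Measurable R) {cR : ℝ} (hR : ∀ z, R z ≤ cR)
    (hHR : ∀ z s, ‖H z s‖ ≤ R z) (hH0 : ∀ z, ∫ s, H z s ∂π = 0) :
    ∫ z, ‖∑ i ∈ Finset.range n, H z (z (T + (i + 1)))‖ ^ 2 ∂(pathLaw Z P)
      ≤ 16 / 3 * τ * n * ∫ z, R z ^ 2 ∂(pathLaw Z P) := by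
  have := hZ.isProbabilityMeasure_pathLaw
  have hR0 : ∀ z : ℕ → S, 0 ≤ R z := fun z => (norm_nonneg _).trans (hHR z (z 0))
  have hHi : ∀ i, Measurable fun z : ℕ → S => H z (z i) := fun i =>
    hHm.comp (measurable_id.prodMk (measurable_pi_apply _))
  have hR2 : Integrable (fun z => R z ^ 2) (pathLaw Z P) :=
    Integrable.of_bound (hRm.pow_const 2).aestronglyMeasurable (cR ^ 2)
      (Filter.Eventually.of_forall fun z => by
        rw [Real.norm_of_nonneg (by positivity)]
        exact pow_le_pow_left₀ (hR0 z) (hR z) 2)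
  have hI : 0 ≤ ∫ z, R z ^ 2 ∂(pathLaw Z P) := integral_nonneg fun z => by positivity
  have hsb : ∀ (n : ℕ) (z : ℕ → S), ‖∑ i ∈ Finset.range n, H z (z (T + (i + 1)))‖ ≤ n * cR := by
    intro n z
    refine (norm_sum_le_of_le _ fun i _ => (hHR z _).trans (hR z)).trans ?_
    simp
  have hsm : ∀ n : ℕ, Measurable fun z : ℕ → S => ∑ i ∈ Finset.range n, H z (z (T + (i + 1))) :=
    fun n => Finset.measurable_sum _ fun i _ => hHi _
  induction n with
  | zero => simp
  | succ n ih =>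
    have hexp : ∀ z : ℕ → S, ‖∑ i ∈ Finset.range (n + 1), H z (z (T + (i + 1)))‖ ^ 2
        ≤ ‖∑ i ∈ Finset.range n, H z (z (T + (i + 1)))‖ ^ 2
          + 2 * ∑ i ∈ Finset.range n, inner ℝ (H z (z (T + (i + 1)))) (H z (z (T + (n + 1))))
          + R z ^ 2 := by
      intro z
      rw [Finset.sum_range_succ, norm_add_sq_real, sum_inner]
      have := pow_le_pow_left₀ (norm_nonneg _) (hHR z (z (T + (n + 1)))) 2
      linarith
    have hi1 : ∀ n : ℕ, Integrable (fun z : ℕ → S =>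
        ‖∑ i ∈ Finset.range n, H z (z (T + (i + 1)))‖ ^ 2) (pathLaw Z P) := fun n =>
      Integrable.of_bound ((hsm n).norm.pow_const 2).aestronglyMeasurable ((n * cR) ^ 2)
        (Filter.Eventually.of_forall fun z => by
          rw [Real.norm_of_nonneg (by positivity)]
          exact pow_le_pow_left₀ (norm_nonneg _) (hsb n z) 2)
    have hi2 : ∀ i j : ℕ, Integrable (fun z : ℕ → S => inner ℝ (H z (z i)) (H z (z j)))
        (pathLaw Z P) := fun i j =>
      Integrable.of_bound ((hHi i).inner (hHi j)).aestronglyMeasurable (cR * cR)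
        (Filter.Eventually.of_forall fun z => (norm_inner_le_norm _ _).trans
          (mul_le_mul ((hHR _ _).trans (hR z)) ((hHR _ _).trans (hR z)) (norm_nonneg _)
            ((norm_nonneg _).trans ((hHR z (z 0)).trans (hR z)))))
    have hi3 := (integrable_finsetSum (Finset.range n) fun i _ =>
      hi2 (T + (i + 1)) (T + (n + 1))).const_mul 2
    -- The earlier noise takes the role of the past at time T + (i + 1). The lag n - i is written n
    -- - 1 - i + 1 so that `Finset.sum_range_reflect` can reverse the sum.
    have hcross : ∀ i ∈ Finset.range n,
        ∫ z, inner ℝ (H z (z (T + (i + 1)))) (H z (z (T + (n + 1)))) ∂(pathLaw Z P)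
          ≤ 2 * (1 / 4) ^ ((n - 1 - i + 1) / τ) * ∫ z, R z ^ 2 ∂(pathLaw Z P) := by
      intro i hi
      have hlt := Finset.mem_range.1 hi
      have hT1 : DependsOn (fun z : ℕ → S => H z (z (T + (i + 1)))) (Set.Iic (T + (i + 1))) :=
        fun z z' h => by
          simp only [hHT fun k hk => h k (le_trans hk (Nat.le_add_right _ _)),
            h (T + (i + 1)) (Set.mem_Iic.2 le_rfl)]
      have h1 := hZ.integral_inner_noise_le hQ (T := T + (i + 1)) (n - 1 - i + 1)
        (hHi (T + (i + 1))) (fun z => (hHR _ _).trans (hR z)) hT1 hHm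
        (hHT.mono (Set.Iic_subset_Iic.2 (Nat.le_add_right _ _))) hRm hR hHR hH0
      rw [show T + (i + 1) + (n - 1 - i + 1) = T + (n + 1) by omega] at h1
      refine h1.trans (mul_le_mul_of_nonneg_left ?_ (by positivity))
      refine integral_mono ?_ hR2 fun z => ?_
      · refine Integrable.of_bound ((hHi _).norm.mul hRm).aestronglyMeasurable (cR * cR)
          (Filter.Eventually.of_forall fun z => ?_)
        rw [Real.norm_of_nonneg (mul_nonneg (norm_nonneg _) (hR0 z))]
        exact mul_le_mul ((hHR _ _).trans (hR z)) (hR z) (hR0 z) ((hR0 z).trans (hR z))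
      · simp only [sq]
        exact mul_le_mul_of_nonneg_right (hHR _ _) (hR0 z)
    have hcs := (Finset.sum_le_sum hcross)
    rw [← Finset.sum_mul, ← Finset.mul_sum,
      Finset.sum_range_reflect (fun i => (1 / 4 : ℝ) ^ ((i + 1) / τ)) n] at hcs
    have hcs' := hcs.trans (mul_le_mul_of_nonneg_right (mul_le_mul_of_nonneg_left
      (sum_range_pow_succ_div_le τ hQ.mixing_time_pos n) zero_le_two) hI)
    have hle := integral_mono (hi1 (n + 1)) (((hi1 n).add hi3).add hR2) hexp
    rw [integral_add' ((hi1 n).add hi3) hR2, integral_add' (hi1 n) hi3, integral_const_mul,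
      integral_finsetSum _ fun i _ => hi2 _ _] at hle
    push_cast
    -- A new noise costs at most 1 + 4(4τ/3 - 1) ≤ 16τ/3 times ∫ R².
    nlinarith [hle, ih, hcs', hI]

end Noise

/-! ### Measurability of the stochastic gradient -/

/-- Joint measurability of the stochastic gradient. -/
theorem measurable_uncurry_stochGrad {d : ℕ} {S : Type*} [MeasurableSpace S]
    {F : EuclideanSpace ℝ (Fin d) → S → ℝ} (hFm : ∀ x, Measurable (F x))
    (hFd : ∀ z, Differentiable ℝ (fun x => F x z)) :
    Measurable (Function.uncurry (stochGrad F)) := by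
  have hF : Measurable (Function.uncurry F) :=
    measurable_uncurry_of_continuous_of_measurable (fun z => (hFd z).continuous) hFm
  have hcoord : ∀ i : Fin d, Measurable fun q : EuclideanSpace ℝ (Fin d) × S =>
      stochGrad F q.1 q.2 i := by
    intro i
    -- Each coordinate is a limit of difference quotients with increment 1/n, which are jointly
    -- measurable because F is continuous in x and measurable in z.
    have hlim : ∀ q : EuclideanSpace ℝ (Fin d) × S, Filter.Tendsto
        (fun n : ℕ => (n : ℝ) • (F (q.1 + (n : ℝ)⁻¹ • EuclideanSpace.single i 1) q.2 - F q.1 q.2))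
        Filter.atTop (nhds (stochGrad F q.1 q.2 i)) := by
      intro q
      have h1 := ((hFd q.2) q.1).hasFDerivAt.lim (EuclideanSpace.single i (1 : ℝ))
        (c := fun n : ℕ => (n : ℝ)) (l := Filter.atTop)
        (by simpa using tendsto_natCast_atTop_atTop)
      have h2 : fderiv ℝ (fun x => F x q.2) q.1 (EuclideanSpace.single i (1 : ℝ))
          = stochGrad F q.1 q.2 i := by
        rw [← toDual_gradient, InnerProductSpace.toDual_apply_apply, stochGrad,
          EuclideanSpace.inner_single_right]
        simp only [one_mul, conj_trivial]
      rwa [h2] at h1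
    refine measurable_of_tendsto_metrizable (fun n => ?_) (tendsto_pi_nhds.2 hlim)
    exact ((hF.comp ((measurable_fst.add_const _).prodMk measurable_snd)).sub hF).const_smul (n : ℝ)
  have h : Function.uncurry (stochGrad F) = fun q =>
      WithLp.toLp 2 (fun i => stochGrad F q.1 q.2 i) := rfl
  rw [h]
  exact (WithLp.measurable_toLp 2 _).comp (measurable_pi_lambda _ hcoord)

/-! ### Deterministic one-step analysis -/

section Deterministic

variable {d : ℕ} {f : EuclideanSpace ℝ (Fin d) → ℝ} {L μ : ℝ}

/-- A descent inequality for smooth convex functions. -/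
theorem IsLSmooth.le_add_inner_add (hL : IsLSmooth f L) (hμ : IsStronglyConvex f μ)
    (x y : EuclideanSpace ℝ (Fin d)) :
    f y ≤ f x + inner ℝ (gradient f x) (y - x) + L * ‖y - x‖ ^ 2 := by
  -- Convexity at y compares gradients at the endpoints only and avoids integrating along the
  -- segment, at the price of L in place of L/2.
  have h1 := hμ.lower_bound x y
  have h2 : 0 ≤ μ / 2 * ‖x - y‖ ^ 2 := mul_nonneg (by linarith [hμ.pos]) (by positivity)
  have h3 : inner ℝ (gradient f y) (x - y) = - inner ℝ (gradient f x) (y - x)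
      - inner ℝ (gradient f y - gradient f x) (y - x) := by
    rw [inner_sub_left, ← neg_sub y x, inner_neg_right]; ring
  have h4 : inner ℝ (gradient f y - gradient f x) (y - x) ≤ L * ‖y - x‖ ^ 2 := by
    refine (real_inner_le_norm _ _).trans ?_
    have := mul_le_mul_of_nonneg_right (hL.lipschitz y x) (norm_nonneg (y - x))
    linarith
  linarith

/-- Adding the strong convexity inequalities for (x, y) and (y, x) gives strong monotonicity of the
gradient, to be compared with its Lipschitz bound. Two distinct points are needed, so dimension zero
is excluded. -/
theorem IsStronglyConvex.le_of_isLSmooth (hμ : IsStronglyConvex f μ) (hL : IsLSmooth f L)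
    [Nontrivial (EuclideanSpace ℝ (Fin d))] : μ ≤ L := by
  obtain ⟨x, y, hxy⟩ := exists_pair_ne (EuclideanSpace ℝ (Fin d))
  have h1 := hμ.lower_bound x y
  have h2 := hμ.lower_bound y x
  have h3 : inner ℝ (gradient f y) (x - y) + inner ℝ (gradient f x) (y - x)
      = - inner ℝ (gradient f x - gradient f y) (x - y) := by
    rw [inner_sub_left, ← neg_sub x y, inner_neg_right]; ring
  have h4 : inner ℝ (gradient f x - gradient f y) (x - y) ≤ L * ‖x - y‖ ^ 2 := by
    refine (real_inner_le_norm _ _).trans ?_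
    have := mul_le_mul_of_nonneg_right (hL.lipschitz x y) (norm_nonneg (x - y))
    linarith
  rw [norm_sub_rev y x] at h2
  have h5 : 0 < ‖x - y‖ ^ 2 := by have := norm_pos_iff.2 (sub_ne_zero.2 hxy); positivity
  exact le_of_mul_le_mul_right (by linarith) h5

theorem IsLSmooth.continuous_gradient (hL : IsLSmooth f L) : Continuous (gradient f) :=
  (LipschitzWith.of_dist_le_mul (K := ⟨L, hL.pos.le⟩) fun x y => by
    rw [dist_eq_norm, dist_eq_norm]; exact hL.lipschitz x y).continuous

/-- The relations between the parameters of the accelerated method that its analysis uses. -/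
structure IsAccParam (μ γ p β η θ : ℝ) : Prop where
  mu_pos : 0 < μ
  gamma_pos : 0 < γ
  p_pos : 0 < p
  beta_pos : 0 < β
  beta_le : β ≤ 1
  eta_eq : η = 2 * p / β
  sq_eq : p ^ 2 * γ = 3 * β ^ 2 / (4 * μ)
  theta_eq : θ = (1 - β / 2) / (1 - β ^ 2 / 2)

namespace IsAccParam

variable {γ p β η θ : ℝ} (h : IsAccParam μ γ p β η θ)

include h

theorem denom_pos : 0 < 2 - β ^ 2 := by nlinarith [h.beta_pos, h.beta_le]

theorem theta_eq_div : θ = (2 - β) / (2 - β ^ 2) := by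
  have := h.denom_pos
  rw [h.theta_eq, show 1 - β / 2 = (2 - β) / 2 by ring, show 1 - β ^ 2 / 2 = (2 - β ^ 2) / 2 by ring]
  field_simp

/-- The momentum update as a gradient step from `(1 - β) x + β x_g`. -/
theorem momentum_eq {V : Type*} [AddCommGroup V] [Module ℝ V] (x xf g : V) :
    η • ((θ • xf + (1 - θ) • x) - (p * γ) • g) + (p - η) • xf + ((1 - p) * (1 - β)) • x
        + ((1 - p) * β) • (θ • xf + (1 - θ) • x)
      = ((1 - β) • x + β • (θ • xf + (1 - θ) • x)) - (3 * β / (2 * μ)) • g := by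
  have hd := h.denom_pos
  have hβ := h.beta_pos
  have h1 : η * p * γ = 3 * β / (2 * μ) := by
    have := h.sq_eq
    have hμ := h.mu_pos
    rw [h.eta_eq]
    calc 2 * p / β * p * γ = 2 / β * (p ^ 2 * γ) := by ring
      _ = _ := by rw [this]; field_simp; ring
  have e1 : η * θ + (p - η) + (1 - p) * β * θ = β * θ := by
    rw [h.eta_eq, h.theta_eq_div]; field_simp; ring
  have e2 : η * (1 - θ) + (1 - p) * (1 - β) + (1 - p) * β * (1 - θ) = 1 - β + β * (1 - θ) := by
    rw [h.eta_eq, h.theta_eq_div]; field_simp; ring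
  calc _ = (η * θ + (p - η) + (1 - p) * β * θ) • xf
        + (η * (1 - θ) + (1 - p) * (1 - β) + (1 - p) * β * (1 - θ)) • x - (η * p * γ) • g := by module
    _ = _ := by rw [e1, e2, h1]; module

/-- The value of θ makes the starting point of the momentum step an extrapolation from x_f through
x_g. This is what turns ⟨∇f(x_g), y - x*⟩ into function gaps at x* and x_f. -/
theorem mix_eq {V : Type*} [AddCommGroup V] [Module ℝ V] (x xf : V) :
    (1 - β) • x + β • (θ • xf + (1 - θ) • x)
      = (θ • xf + (1 - θ) • x) + (2 / β - 1) • ((θ • xf + (1 - θ) • x) - xf) := by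
  have hd := h.denom_pos
  have hβ := h.beta_pos
  have e1 : β * θ = θ + (2 / β - 1) * (θ - 1) := by
    rw [h.theta_eq_div]; field_simp; ring
  have e2 : 1 - β + β * (1 - θ) = (1 - θ) + (2 / β - 1) * (1 - θ) := by
    rw [h.theta_eq_div]; field_simp; ring
  calc _ = (β * θ) • xf + (1 - β + β * (1 - θ)) • x := by module
    _ = _ := by rw [e1, e2]; module

/-- One-step inequality for the potential, with gradient error `e`. -/
theorem potential_step_le (hL : IsLSmooth f L) (hμ : IsStronglyConvex f μ)
    (xs x xf e xg y : EuclideanSpace ℝ (Fin d)) (hxg : xg = θ • xf + (1 - θ) • x)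
    (hy : y = (1 - β) • x + β • xg) :
    ‖η • (xg - (p * γ) • (gradient f xg + e)) + (p - η) • xf + ((1 - p) * (1 - β)) • x
        + ((1 - p) * β) • xg - xs‖ ^ 2
      + 6 / μ * (f (xg - (p * γ) • (gradient f xg + e)) - f xs)
    ≤ (1 - β) * ‖x - xs‖ ^ 2 + (1 - β / 2) * (6 / μ * (f xf - f xs)) - β / 2 * ‖xg - xs‖ ^ 2
      + (2 * (3 * p * γ / μ * (p * (1 + 2 * γ * L))) - 2 * (3 * p * γ / μ)) * ‖gradient f xg‖ ^ 2
      + 2 * (3 * p * γ / μ * (p * (1 + 2 * γ * L))) * ‖e‖ ^ 2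
      + inner ℝ (-((2 * (3 * p * γ / μ)) • gradient f xg + (3 * β / μ) • (y - xs))) e := by
  have hμ0 := h.mu_pos
  have hβ := h.beta_pos
  have hγ := h.gamma_pos
  have hp := h.p_pos
  set n := gradient f xg with hn
  set w := 3 * β / (2 * μ) with hw
  set κ := 3 * p * γ / μ with hκ
  have hw2 : w ^ 2 = κ * p := by
    have := h.sq_eq
    calc w ^ 2 = 3 / μ * (3 * β ^ 2 / (4 * μ)) := by rw [hw]; field_simp; ring
      _ = κ * p := by rw [← this, hκ]; ring
  have hx' : η • (xg - (p * γ) • (n + e)) + (p - η) • xf + ((1 - p) * (1 - β)) • x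
      + ((1 - p) * β) • xg - xs = (y - xs) - w • (n + e) := by
    have := h.momentum_eq x xf (n + e)
    rw [← hxg, ← hy] at this
    rw [this]; abel
  have hyx : y - xs = (xg - xs) + (2 / β - 1) • (xg - xf) := by
    have := h.mix_eq x xf
    rw [← hxg, ← hy] at this
    rw [this]; abel
  have hconv : ‖y - xs‖ ^ 2 ≤ (1 - β) * ‖x - xs‖ ^ 2 + β * ‖xg - xs‖ ^ 2 := by
    have h1 : y - xs = (1 - β) • (x - xs) + β • (xg - xs) := by rw [hy]; module
    have h2 : ‖y - xs‖ ^ 2 = (1 - β) * ‖x - xs‖ ^ 2 + β * ‖xg - xs‖ ^ 2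
        - β * (1 - β) * ‖(x - xs) - (xg - xs)‖ ^ 2 := by
      rw [h1, norm_add_sq_real, norm_sub_sq_real (x - xs) (xg - xs), norm_smul, norm_smul, inner_smul_left,
        inner_smul_right, mul_pow, mul_pow, Real.norm_eq_abs, Real.norm_eq_abs, sq_abs, sq_abs]
      simp only [conj_trivial]
      ring
    have h3 : 0 ≤ β * (1 - β) * ‖(x - xs) - (xg - xs)‖ ^ 2 :=
      mul_nonneg (mul_nonneg hβ.le (by linarith [h.beta_le])) (by positivity)
    linarith
  have hsc1 := hμ.lower_bound xs xg
  have hsc2 := hμ.lower_bound xf xg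
  have hsc2' : 0 ≤ μ / 2 * ‖xf - xg‖ ^ 2 := by positivity
  rw [← hn] at hsc1 hsc2
  have hin1 : inner ℝ n (xs - xg) = - inner ℝ n (xg - xs) := by
    rw [← inner_neg_right, neg_sub]
  have hin2 : inner ℝ n (xf - xg) = - inner ℝ n (xg - xf) := by
    rw [← inner_neg_right, neg_sub]
  rw [hin1, norm_sub_rev xs xg] at hsc1
  rw [hin2] at hsc2
  have hny : inner ℝ n (y - xs) = inner ℝ n (xg - xs) + (2 / β - 1) * inner ℝ n (xg - xf) := by
    rw [hyx, inner_add_right, inner_smul_right]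
  have hβ2 : 0 ≤ 2 / β - 1 := by
    rw [sub_nonneg, le_div_iff₀ hβ]; linarith [h.beta_le]
  -- The quadratic term of strong convexity is kept towards x* and dropped towards x_f.
  have hlow : f xg - f xs + μ / 2 * ‖xg - xs‖ ^ 2 + (2 / β - 1) * (f xg - f xf)
      ≤ inner ℝ n (y - xs) := by
    rw [hny]
    have := mul_le_mul_of_nonneg_left (show f xg - f xf ≤ inner ℝ n (xg - xf) by linarith) hβ2
    linarith
  have hdesc := hL.le_add_inner_add hμ xg (xg - (p * γ) • (n + e))
  rw [← hn, show xg - (p * γ) • (n + e) - xg = -((p * γ) • (n + e)) by abel, inner_neg_right,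
    norm_neg, norm_smul, inner_smul_right, mul_pow, Real.norm_eq_abs, sq_abs, inner_add_right,
    real_inner_self_eq_norm_sq] at hdesc
  have hg2 : ‖n + e‖ ^ 2 ≤ 2 * ‖n‖ ^ 2 + 2 * ‖e‖ ^ 2 := by
    nlinarith [norm_add_le n e, norm_nonneg (n + e), sq_nonneg (‖n‖ - ‖e‖), norm_nonneg n,
      norm_nonneg e]
  have hexp : ‖(y - xs) - w • (n + e)‖ ^ 2
      = ‖y - xs‖ ^ 2 - 2 * w * (inner ℝ n (y - xs) + inner ℝ e (y - xs)) + κ * p * ‖n + e‖ ^ 2 := by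
    rw [norm_sub_sq_real, inner_smul_right, norm_smul, mul_pow, Real.norm_eq_abs, sq_abs, hw2,
      inner_add_right, real_inner_comm n, real_inner_comm e]
    ring
  have hinr : inner ℝ (-((2 * κ) • n + (3 * β / μ) • (y - xs))) e
      = - (2 * κ) * inner ℝ n e - 2 * w * inner ℝ e (y - xs) := by
    rw [inner_neg_left, inner_add_left, inner_smul_left, inner_smul_left, real_inner_comm e (y - xs)]
    simp only [conj_trivial]
    rw [hw]; field_simp; ring
  rw [hx', hexp, hinr]
  have hw0 : 0 < w := by positivity
  have hκ0 : 0 < κ := by positivity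
  have k1 := mul_le_mul_of_nonneg_left hlow (show 0 ≤ 2 * w by positivity)
  have k2 := mul_le_mul_of_nonneg_left hdesc (show 0 ≤ 6 / μ by positivity)
  have k3 := mul_le_mul_of_nonneg_left hg2 (show 0 ≤ κ * (p * (1 + 2 * γ * L)) by
    have := hL.pos; positivity)
  have k2' : 6 / μ * (f xg + -(p * γ * (‖n‖ ^ 2 + inner ℝ n e)) + L * ((p * γ) ^ 2 * ‖n + e‖ ^ 2))
      = 6 / μ * f xg - 2 * κ * (‖n‖ ^ 2 + inner ℝ n e) + 2 * κ * p * γ * L * ‖n + e‖ ^ 2 := by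
    rw [hκ]; field_simp; ring
  -- Since 2w · (2/β) = 6/μ, the f(x_g) terms cancel those of the descent inequality; this is the
  -- origin of the weight 6/μ in the potential.
  have k1' : 2 * w * (f xg - f xs + μ / 2 * ‖xg - xs‖ ^ 2 + (2 / β - 1) * (f xg - f xf))
      = 6 / μ * (f xg - f xs) - (1 - β / 2) * (6 / μ * (f xf - f xs))
        + 3 / 2 * β * ‖xg - xs‖ ^ 2 := by
    rw [hw]; field_simp; ring
  rw [k2'] at k2
  rw [k1'] at k1
  linarith

end IsAccParam

/-- Young's inequality applied to the bias terms, and the resulting contraction. -/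
theorem contraction_of_bounds {X2 G2 c Y N r ρ W σ δ V μ β κ A D a q : ℝ} (hμ : 0 < μ)
    (hβ : 0 < β) (hβ1 : β ≤ 1) (hκ : 0 < κ) (hX : 0 ≤ X2) (hG : 0 ≤ G2)
    (hr : 0 ≤ r) (hρ : 0 ≤ ρ) (hr2 : r ^ 2 = σ ^ 2 + δ ^ 2 * N ^ 2)
    (hW : W ≤ 2 * κ * N + 3 * β / μ * Y) (hY : Y ^ 2 ≤ (1 - β) * X2 + β * G2)
    (hq : 9 * β / (2 * μ ^ 2) = κ * q) (ha : 2 * a * (1 + V * δ ^ 2) ≤ 3 / 2 * κ)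
    (haV : 2 * a * V ≤ κ * A) (hD : (4 + q) * ρ ^ 2 ≤ D) (hDδ : D * δ ^ 2 ≤ 1 / 4) :
    (1 - β) * X2 + (1 - β / 2) * c - β / 2 * G2 + (2 * a - 2 * κ) * N ^ 2 + 2 * a * (V * r ^ 2)
      + ρ * (W * r) ≤ (1 - β / 2) * (X2 + c) + κ * (A + D) * σ ^ 2 := by
  have h1 : ρ * (W * r) ≤ ρ * ((2 * κ * N + 3 * β / μ * Y) * r) :=
    mul_le_mul_of_nonneg_left (mul_le_mul_of_nonneg_right hW hr) hρ
  have h2 : 2 * κ * N * (ρ * r) ≤ κ * (N ^ 2 / 4 + 4 * (ρ * r) ^ 2) := by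
    have := mul_nonneg hκ.le (sq_nonneg (N / 2 - 2 * (ρ * r)))
    linarith
  have h3 : 3 * β / μ * Y * (ρ * r) ≤ β / 2 * Y ^ 2 + 9 * β / (2 * μ ^ 2) * (ρ * r) ^ 2 := by
    have h : 0 ≤ β / 2 * (Y - 3 / μ * (ρ * r)) ^ 2 := by positivity
    have h' : β / 2 * (Y - 3 / μ * (ρ * r)) ^ 2 = β / 2 * Y ^ 2
        + 9 * β / (2 * μ ^ 2) * (ρ * r) ^ 2 - 3 * β / μ * Y * (ρ * r) := by
      field_simp; ring
    linarith
  have h4 : β / 2 * Y ^ 2 ≤ β / 2 * X2 + β / 2 * G2 := by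
    have : Y ^ 2 ≤ X2 + G2 := by nlinarith
    nlinarith
  rw [hq] at h3
  have h5 : κ * ((4 + q) * ρ ^ 2) * r ^ 2 ≤ κ * D * r ^ 2 :=
    mul_le_mul_of_nonneg_right (mul_le_mul_of_nonneg_left hD hκ.le) (by positivity)
  have h6 : κ * D * r ^ 2 ≤ κ * D * σ ^ 2 + κ / 4 * N ^ 2 := by
    rw [hr2]
    have := mul_le_mul_of_nonneg_left hDδ (show 0 ≤ κ * N ^ 2 by positivity)
    linarith
  have h7 : 2 * a * N ^ 2 + 2 * a * (V * r ^ 2) ≤ 3 / 2 * κ * N ^ 2 + κ * A * σ ^ 2 := by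
    rw [hr2]
    have e1 := mul_le_mul_of_nonneg_right ha (sq_nonneg N)
    have e2 := mul_le_mul_of_nonneg_right haV (sq_nonneg σ)
    linarith
  -- The budgets close exactly: 3/2 + 1/4 + 1/4 = 2 for κN², (1 - β) + β/2 = 1 - β/2 for X2, and β/2
  -- - β/2 = 0 for G2.
  linarith

end Deterministic

/-! ### Stochastic oracle and batch averages -/

/-- An unbiased stochastic gradient with bounded growth, jointly measurable, of a function with
continuous gradient. -/
structure IsGradientOracle {d : ℕ} {S : Type*} [MeasurableSpace S]
    (F : EuclideanSpace ℝ (Fin d) → S → ℝ) (f : EuclideanSpace ℝ (Fin d) → ℝ) (π : Measure S)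
    (σ δ : ℝ) : Prop where
  measurable : Measurable (Function.uncurry (stochGrad F))
  continuous : Continuous f
  continuous_gradient : Continuous (gradient f)
  unbiased : ∀ x, ∫ z, stochGrad F x z ∂π = gradient f x
  bound : ∀ x z, ‖stochGrad F x z - gradient f x‖ ^ 2 ≤ σ ^ 2 + δ ^ 2 * ‖gradient f x‖ ^ 2

/-- The pointwise bound `(σ² + δ² ‖∇f(x)‖²)^{1/2}` on the noise. -/
noncomputable def noiseLevel {d : ℕ} (f : EuclideanSpace ℝ (Fin d) → ℝ) (σ δ : ℝ)
    (x : EuclideanSpace ℝ (Fin d)) : ℝ :=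
  Real.sqrt (σ ^ 2 + δ ^ 2 * ‖gradient f x‖ ^ 2)

theorem noiseLevel_sq {d : ℕ} (f : EuclideanSpace ℝ (Fin d) → ℝ) (σ δ : ℝ)
    (x : EuclideanSpace ℝ (Fin d)) :
    noiseLevel f σ δ x ^ 2 = σ ^ 2 + δ ^ 2 * ‖gradient f x‖ ^ 2 :=
  Real.sq_sqrt (by positivity)

theorem noiseLevel_nonneg {d : ℕ} (f : EuclideanSpace ℝ (Fin d) → ℝ) (σ δ : ℝ)
    (x : EuclideanSpace ℝ (Fin d)) : 0 ≤ noiseLevel f σ δ x := Real.sqrt_nonneg _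

/-- A continuous function is bounded along a bounded family of points. -/
theorem Continuous.exists_norm_le_of_norm_le {d : ℕ} {V : Type*} [NormedAddCommGroup V]
    {φ : EuclideanSpace ℝ (Fin d) → V} (hφ : Continuous φ) (c : ℝ) :
    ∃ C, 0 ≤ C ∧ ∀ x, ‖x‖ ≤ c → ‖φ x‖ ≤ C := by
  obtain ⟨C, hC⟩ := (isCompact_closedBall (0 : EuclideanSpace ℝ (Fin d)) c).exists_bound_of_continuousOn
    hφ.continuousOn
  exact ⟨max C 0, le_max_right _ _, fun x hx =>
    (hC x (mem_closedBall_zero_iff.2 hx)).trans (le_max_left _ _)⟩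

theorem sum_Icc_one_eq_sum_range {V : Type*} [AddCommMonoid V] (a : ℕ → V) (n : ℕ) :
    ∑ i ∈ Finset.Icc 1 n, a i = ∑ i ∈ Finset.range n, a (i + 1) := by
  induction n with
  | zero => simp
  | succ n ih => rw [Finset.sum_Icc_succ_top (by omega), ih, Finset.sum_range_succ]

theorem batchGrad_sub {d : ℕ} {S : Type*} (F : EuclideanSpace ℝ (Fin d) → S → ℝ) (z : ℕ → S)
    {B : ℕ} (hB : 0 < B) (T j : ℕ) (x v : EuclideanSpace ℝ (Fin d)) :
    batchGrad F z B T j x - v = ((2 : ℝ) ^ j * (B : ℝ))⁻¹ •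
      ∑ i ∈ Finset.range (2 ^ j * B), (stochGrad F x (z (T + (i + 1))) - v) := by
  have hB' : (0 : ℝ) < 2 ^ j * B := by positivity
  rw [batchGrad, sum_Icc_one_eq_sum_range, Finset.sum_sub_distrib, smul_sub, Finset.sum_const,
    Finset.card_range, ← Nat.cast_smul_eq_nsmul ℝ]
  push_cast
  rw [inv_smul_smul₀ hB'.ne']

namespace IsGradientOracle

variable {d : ℕ} {S Ω : Type*} [MeasurableSpace S] [MeasurableSpace Ω]
  {F : EuclideanSpace ℝ (Fin d) → S → ℝ} {f : EuclideanSpace ℝ (Fin d) → ℝ} {π : Measure S}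
  {σ δ : ℝ}

theorem norm_noise_le (h : IsGradientOracle F f π σ δ) (x : EuclideanSpace ℝ (Fin d)) (z : S) :
    ‖stochGrad F x z - gradient f x‖ ≤ noiseLevel f σ δ x :=
  Real.le_sqrt_of_sq_le (h.bound x z)

theorem integral_noise (h : IsGradientOracle F f π σ δ) [IsProbabilityMeasure π]
    (x : EuclideanSpace ℝ (Fin d)) : ∫ z, (stochGrad F x z - gradient f x) ∂π = 0 := by
  have hi : Integrable (fun z => stochGrad F x z - gradient f x) π :=
    Integrable.of_bound (h.measurable.of_uncurry_left.sub_const _).aestronglyMeasurable _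
      (Filter.Eventually.of_forall (h.norm_noise_le x))
  have hi' : Integrable (fun z => stochGrad F x z) π := by
    refine (hi.add (integrable_const (gradient f x))).congr (Filter.Eventually.of_forall fun z => ?_)
    simp only [Pi.add_apply, sub_add_cancel]
  rw [integral_sub hi' (integrable_const _), h.unbiased]
  simp

theorem continuous_noiseLevel (h : IsGradientOracle F f π σ δ) : Continuous (noiseLevel f σ δ) :=
  Real.continuous_sqrt.comp
    (continuous_const.add (continuous_const.mul (h.continuous_gradient.norm.pow 2)))

theorem exists_batchGrad_bound (h : IsGradientOracle F f π σ δ) (B : ℕ) (c : ℝ) :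
    ∃ C, 0 ≤ C ∧ ∀ (z : ℕ → S) T j x, ‖x‖ ≤ c → ‖batchGrad F z B T j x‖ ≤ C := by
  obtain ⟨C1, h1, hC1⟩ := h.continuous_gradient.exists_norm_le_of_norm_le c
  obtain ⟨C2, h2, hC2⟩ := h.continuous_noiseLevel.exists_norm_le_of_norm_le c
  refine ⟨C1 + C2, by positivity, fun z T j x hx => ?_⟩
  have hg : ∀ s, ‖stochGrad F x s‖ ≤ C1 + C2 := fun s => by
    have e1 := norm_le_norm_add_norm_sub' (stochGrad F x s) (gradient f x)
    have e2 := h.norm_noise_le x s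
    have e3 := (le_abs_self _).trans (hC2 x hx)
    have e4 := hC1 x hx
    linarith
  rw [batchGrad, norm_smul]
  have hsum : ‖∑ i ∈ Finset.Icc 1 (2 ^ j * B), stochGrad F x (z (T + i))‖
      ≤ (2 ^ j * B : ℝ) * (C1 + C2) := by
    refine (norm_sum_le_of_le _ fun i _ => hg _).trans ?_
    simp [mul_add]
  have h0 : (0 : ℝ) ≤ 2 ^ j * B := by positivity
  rw [norm_inv, Real.norm_of_nonneg h0]
  refine (mul_le_mul_of_nonneg_left hsum (inv_nonneg.2 h0)).trans ?_
  rw [← mul_assoc]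
  refine mul_le_of_le_one_left (by positivity) ?_
  exact inv_mul_le_one

/-- The cutoff 2^j ≤ M bounds the correction factor, so the bound is uniform over all levels. -/
theorem exists_mlmcGrad_bound (h : IsGradientOracle F f π σ δ) (B : ℕ) (M c : ℝ) :
    ∃ C, 0 ≤ C ∧ ∀ (z : ℕ → S) T j x, ‖x‖ ≤ c → ‖mlmcGrad F z M B T j x‖ ≤ C := by
  obtain ⟨C, h0, hC⟩ := h.exists_batchGrad_bound B c
  refine ⟨C + |M| * (C + C), by positivity, fun z T j x hx => ?_⟩
  rw [mlmcGrad]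
  refine (norm_add_le _ _).trans (add_le_add (hC _ _ _ _ hx) ?_)
  split_ifs with hj
  · rw [norm_smul, Real.norm_of_nonneg (by positivity)]
    exact mul_le_mul (hj.trans (le_abs_self _))
      ((norm_sub_le _ _).trans (add_le_add (hC _ _ _ _ hx) (hC _ _ _ _ hx))) (norm_nonneg _)
      (abs_nonneg _)
  · rw [norm_zero]; positivity

theorem measurable_batchGrad (h : IsGradientOracle F f π σ δ) (B T j : ℕ) :
    Measurable fun q : EuclideanSpace ℝ (Fin d) × (ℕ → S) => batchGrad F q.2 B T j q.1 := by
  have hs : Measurable fun q : EuclideanSpace ℝ (Fin d) × (ℕ → S) =>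
      ∑ i ∈ Finset.Icc 1 (2 ^ j * B), stochGrad F q.1 (q.2 (T + i)) :=
    Finset.measurable_fun_sum _ fun i _ =>
      h.measurable.comp (measurable_fst.prodMk ((measurable_pi_apply _).comp measurable_snd))
  exact hs.const_smul ((2 : ℝ) ^ j * (B : ℝ))⁻¹

theorem measurable_mlmcGrad (h : IsGradientOracle F f π σ δ) (M : ℝ) (B : ℕ) :
    Measurable fun q : (ℕ × ℕ) × EuclideanSpace ℝ (Fin d) × (ℕ → S) =>
      mlmcGrad F q.2.2 M B q.1.1 q.1.2 q.2.1 := by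
  refine measurable_from_prod_countable_right fun a => ?_
  simp only [mlmcGrad]
  refine (h.measurable_batchGrad _ _ _).add ?_
  split_ifs
  · exact ((h.measurable_batchGrad _ _ _).sub (h.measurable_batchGrad _ _ _)).const_smul
      ((2 : ℝ) ^ a.2)
  · exact measurable_const

variable {Z : ℕ → Ω → S} {Q : Kernel S S} [IsMarkovKernel Q] {P : Measure Ω}
  [IsProbabilityMeasure P] {τ : ℕ}

/-- Mean squared error of a batch average at a point determined by the past. -/
theorem integral_norm_sq_batchGrad_sub_le (h : IsGradientOracle F f π σ δ)
    (hZ : IsMarkovChain Z Q π P) (hQ : IsUniformlyGeometricallyErgodic Q π τ) {B : ℕ} (hB : 0 < B)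
    {T : ℕ} (j : ℕ) {X : (ℕ → S) → EuclideanSpace ℝ (Fin d)} (hXm : Measurable X) {c : ℝ}
    (hX : ∀ z, ‖X z‖ ≤ c) (hXT : DependsOn X (Set.Iic T)) :
    ∫ z, ‖batchGrad F z B T j (X z) - gradient f (X z)‖ ^ 2 ∂(pathLaw Z P)
      ≤ 16 / 3 * τ / (2 ^ j * B) * ∫ z, noiseLevel f σ δ (X z) ^ 2 ∂(pathLaw Z P) := by
  have := hQ.isProbabilityMeasure
  obtain ⟨C, -, hC⟩ := h.continuous_noiseLevel.exists_norm_le_of_norm_le c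
  have hHm : Measurable (Function.uncurry fun (z : ℕ → S) s =>
      stochGrad F (X z) s - gradient f (X z)) :=
    (h.measurable.comp ((hXm.comp measurable_fst).prodMk measurable_snd)).sub
      (h.continuous_gradient.measurable.comp (hXm.comp measurable_fst))
  have key := hZ.integral_norm_sq_sum_noise_le hQ (T := T) (2 ^ j * B) hHm
    (fun z z' e => by simp only [hXT e])
    (R := fun z => noiseLevel f σ δ (X z)) (h.continuous_noiseLevel.measurable.comp hXm)
    (fun z => (le_abs_self _).trans (hC _ (hX z))) (fun z s => h.norm_noise_le _ _)
    (fun z => h.integral_noise _)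
  have hB' : (0 : ℝ) < 2 ^ j * B := by positivity
  simp only [batchGrad_sub F _ hB, norm_smul, mul_pow]
  rw [integral_const_mul]
  refine (mul_le_mul_of_nonneg_left key (by positivity)).trans (le_of_eq ?_)
  rw [Real.norm_of_nonneg (by positivity)]
  push_cast
  field_simp

/-- Bias of a batch average at a point determined by the past. -/
theorem integral_inner_batchGrad_sub_le (h : IsGradientOracle F f π σ δ)
    (hZ : IsMarkovChain Z Q π P) (hQ : IsUniformlyGeometricallyErgodic Q π τ) {B : ℕ} (hB : 0 < B)
    {T : ℕ} (j : ℕ) {X : (ℕ → S) → EuclideanSpace ℝ (Fin d)} (hXm : Measurable X) {c : ℝ}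
    (hX : ∀ z, ‖X z‖ ≤ c) (hXT : DependsOn X (Set.Iic T))
    {U : (ℕ → S) → EuclideanSpace ℝ (Fin d)} (hUm : Measurable U) {cU : ℝ}
    (hU : ∀ z, ‖U z‖ ≤ cU) (hUT : DependsOn U (Set.Iic T)) :
    ∫ z, inner ℝ (U z) (batchGrad F z B T j (X z) - gradient f (X z)) ∂(pathLaw Z P)
      ≤ 8 / 3 * τ / (2 ^ j * B) * ∫ z, ‖U z‖ * noiseLevel f σ δ (X z) ∂(pathLaw Z P) := by
  have := hQ.isProbabilityMeasure
  obtain ⟨C, -, hC⟩ := h.continuous_noiseLevel.exists_norm_le_of_norm_le c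
  have hHm : Measurable (Function.uncurry fun (z : ℕ → S) s =>
      stochGrad F (X z) s - gradient f (X z)) :=
    (h.measurable.comp ((hXm.comp measurable_fst).prodMk measurable_snd)).sub
      (h.continuous_gradient.measurable.comp (hXm.comp measurable_fst))
  have key := hZ.integral_inner_sum_noise_le hQ (T := T) (2 ^ j * B) hUm hU hUT hHm
    (fun z z' e => by simp only [hXT e])
    (R := fun z => noiseLevel f σ δ (X z)) (h.continuous_noiseLevel.measurable.comp hXm)
    (fun z => (le_abs_self _).trans (hC _ (hX z))) (fun z s => h.norm_noise_le _ _)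
    (fun z => h.integral_noise _)
  have hB' : (0 : ℝ) < 2 ^ j * B := by positivity
  simp only [batchGrad_sub F _ hB, inner_smul_right]
  rw [integral_const_mul]
  refine (mul_le_mul_of_nonneg_left key (by positivity)).trans (le_of_eq ?_)
  field_simp

end IsGradientOracle

/-! ### Dependence, measurability and boundedness of the iterates -/

section Iterates

variable {d : ℕ} {S : Type*} {F : EuclideanSpace ℝ (Fin d) → S → ℝ} {γ p β η θ M : ℝ} {B : ℕ}
  {x₀ : EuclideanSpace ℝ (Fin d)}

theorem accIterate_T (z : ℕ → S) (j : ℕ → ℕ) (k : ℕ) :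
    (accIterate F γ p β η θ M B x₀ z j k).T = ∑ i ∈ Finset.range k, 2 ^ j i * B := by
  induction k with
  | zero => rfl
  | succ k ih => rw [Finset.sum_range_succ, ← ih]; rfl

theorem batchGrad_congr {z z' : ℕ → S} {T j : ℕ} (h : ∀ i ≤ T + 2 ^ j * B, z i = z' i)
    (x : EuclideanSpace ℝ (Fin d)) : batchGrad F z B T j x = batchGrad F z' B T j x := by
  rw [batchGrad, batchGrad]
  congr 1
  refine Finset.sum_congr rfl fun i hi => ?_
  rw [h _ (Nat.add_le_add_left (Finset.mem_Icc.1 hi).2 T)]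

theorem mlmcGrad_congr {z z' : ℕ → S} {T j : ℕ} (h : ∀ i ≤ T + 2 ^ j * B, z i = z' i)
    (x : EuclideanSpace ℝ (Fin d)) : mlmcGrad F z M B T j x = mlmcGrad F z' M B T j x := by
  have h' : ∀ m ≤ j, ∀ i ≤ T + 2 ^ m * B, z i = z' i := fun m hm i hi =>
    h i (hi.trans (Nat.add_le_add_left
      (Nat.mul_le_mul_right B (Nat.pow_le_pow_right two_pos hm)) T))
  rw [mlmcGrad, mlmcGrad, batchGrad_congr (h' 0 (Nat.zero_le _)), batchGrad_congr (h' j le_rfl),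
    batchGrad_congr (h' (j - 1) (Nat.sub_le _ _))]

/-- The state after `k` iterations depends only on the first `k` levels and on the noise up to the
current sample counter. -/
theorem accIterate_congr {z z' : ℕ → S} {j j' : ℕ → ℕ} {k : ℕ} (hj : ∀ i < k, j i = j' i)
    (hz : ∀ i ≤ ∑ i ∈ Finset.range k, 2 ^ j i * B, z i = z' i) :
    accIterate F γ p β η θ M B x₀ z j k = accIterate F γ p β η θ M B x₀ z' j' k := by
  induction k with
  | zero => rfl
  | succ k ih =>
    rw [Finset.sum_range_succ] at hz
    have ih' := ih (fun i hi => hj i (hi.trans (Nat.lt_succ_self k)))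
      (fun i hi => hz i (hi.trans (Nat.le_add_right _ _)))
    rw [accIterate, accIterate, ← ih', ← hj k (Nat.lt_succ_self k), accStep, accStep]
    have hm : ∀ x, mlmcGrad F z M B (accIterate F γ p β η θ M B x₀ z j k).T (j k) x
        = mlmcGrad F z' M B (accIterate F γ p β η θ M B x₀ z j k).T (j k) x :=
      mlmcGrad_congr (by rw [accIterate_T]; exact hz)
    simp only [hm]

variable [MeasurableSpace S] {f : EuclideanSpace ℝ (Fin d) → ℝ} {π : Measure S} {σ δ : ℝ}

theorem IsGradientOracle.measurable_accIterate (h : IsGradientOracle F f π σ δ) (k : ℕ) :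
    Measurable (fun q : (ℕ → ℕ) × (ℕ → S) => (accIterate F γ p β η θ M B x₀ q.2 q.1 k).x) ∧
    Measurable (fun q : (ℕ → ℕ) × (ℕ → S) => (accIterate F γ p β η θ M B x₀ q.2 q.1 k).xf) := by
  induction k with
  | zero => exact ⟨measurable_const, measurable_const⟩
  | succ k ih =>
    obtain ⟨hx, hxf⟩ := ih
    have hT : Measurable fun q : (ℕ → ℕ) × (ℕ → S) =>
        (accIterate F γ p β η θ M B x₀ q.2 q.1 k).T := by
      simp only [accIterate_T]
      refine Finset.measurable_fun_sum _ fun i _ => ?_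
      exact (measurable_from_nat (f := fun n => 2 ^ n * B)).comp
        ((measurable_pi_apply i).comp measurable_fst)
    have hg : Measurable fun q : (ℕ → ℕ) × (ℕ → S) =>
        θ • (accIterate F γ p β η θ M B x₀ q.2 q.1 k).xf
          + (1 - θ) • (accIterate F γ p β η θ M B x₀ q.2 q.1 k).x :=
      (hxf.const_smul θ).add (hx.const_smul (1 - θ))
    have hm := (h.measurable_mlmcGrad M B).comp ((hT.prodMk
      ((measurable_pi_apply k).comp measurable_fst)).prodMk (hg.prodMk measurable_snd))
    have hf' := hg.sub (hm.const_smul (p * γ))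
    refine ⟨?_, hf'⟩
    exact (((hf'.const_smul η).add (hxf.const_smul (p - η))).add
      (hx.const_smul ((1 - p) * (1 - β)))).add (hg.const_smul ((1 - p) * β))

/-- The bound may grow with k, but it is uniform in noise and levels; it serves integrability only.
-/
theorem IsGradientOracle.exists_accIterate_bound (h : IsGradientOracle F f π σ δ) (k : ℕ) :
    ∃ c, ∀ (z : ℕ → S) j, ‖(accIterate F γ p β η θ M B x₀ z j k).x‖ ≤ c ∧
      ‖(accIterate F γ p β η θ M B x₀ z j k).xf‖ ≤ c := by
  induction k with
  | zero => exact ⟨‖x₀‖, fun z j => ⟨le_rfl, le_rfl⟩⟩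
  | succ k ih =>
    obtain ⟨c, hc⟩ := ih
    have hs : ∀ (a : ℝ) {v : EuclideanSpace ℝ (Fin d)} {e : ℝ}, ‖v‖ ≤ e → ‖a • v‖ ≤ |a| * e :=
      fun a v e hv => by
        rw [norm_smul]; exact mul_le_mul_of_nonneg_left hv (abs_nonneg a)
    obtain ⟨C, -, hC⟩ := h.exists_mlmcGrad_bound B M (|θ| * c + |1 - θ| * c)
    have hg : ∀ (z : ℕ → S) j, ‖θ • (accIterate F γ p β η θ M B x₀ z j k).xf
          + (1 - θ) • (accIterate F γ p β η θ M B x₀ z j k).x‖ ≤ |θ| * c + |1 - θ| * c :=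
      fun z j => norm_add_le_of_le (hs _ (hc z j).2) (hs _ (hc z j).1)
    have hf' : ∀ (z : ℕ → S) j, ‖(accIterate F γ p β η θ M B x₀ z j (k + 1)).xf‖
        ≤ |θ| * c + |1 - θ| * c + |p * γ| * C :=
      fun z j => norm_sub_le_of_le (hg z j) (hs _ (hC _ _ _ _ (hg z j)))
    obtain ⟨c', hc'⟩ : ∃ c', ∀ (z : ℕ → S) j,
        ‖(accIterate F γ p β η θ M B x₀ z j (k + 1)).x‖ ≤ c' :=
      ⟨_, fun z j => norm_add_le_of_le (norm_add_le_of_le (norm_add_le_of_le (hs _ (hf' z j))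
        (hs _ (hc z j).2)) (hs _ (hc z j).1)) (hs _ (hg z j))⟩
    exact ⟨_, fun z j => ⟨(hc' z j).trans (le_max_left _ _), (hf' z j).trans (le_max_right _ _)⟩⟩

end Iterates

/-! ### The potential and averaging over the random level -/

/-- The potential `‖x - x*‖² + (6/μ) (f(x_f) - f(x*))` of the accelerated method. -/
noncomputable def accPotential {d : ℕ} (f : EuclideanSpace ℝ (Fin d) → ℝ) (μ : ℝ)
    (xs : EuclideanSpace ℝ (Fin d)) (s : AccState d) : ℝ :=
  ‖s.x - xs‖ ^ 2 + 6 / μ * (f s.xf - f xs)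

theorem accPotential_nonneg {d : ℕ} {f : EuclideanSpace ℝ (Fin d) → ℝ} {μ : ℝ} (hμ : 0 < μ)
    {xs : EuclideanSpace ℝ (Fin d)} (hxs : ∀ y, f xs ≤ f y) (s : AccState d) :
    0 ≤ accPotential f μ xs s :=
  add_nonneg (by positivity) (mul_nonneg (by positivity) (sub_nonneg.2 (hxs _)))

/-- A continuous function of two bounded measurable vectors is integrable. -/
theorem integrable_continuous_comp {d : ℕ} {α : Type*} [MeasurableSpace α] {m : Measure α}
    [IsFiniteMeasure m] {u v : α → EuclideanSpace ℝ (Fin d)} (hu : Measurable u)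
    (hv : Measurable v) {cu cv : ℝ} (hcu : ∀ a, ‖u a‖ ≤ cu) (hcv : ∀ a, ‖v a‖ ≤ cv)
    {Ψ : EuclideanSpace ℝ (Fin d) × EuclideanSpace ℝ (Fin d) → ℝ} (hΨ : Continuous Ψ) :
    Integrable (fun a => Ψ (u a, v a)) m := by
  obtain ⟨C, hC⟩ := ((isCompact_closedBall (0 : EuclideanSpace ℝ (Fin d)) cu).prod
    (isCompact_closedBall (0 : EuclideanSpace ℝ (Fin d)) cv)).exists_bound_of_continuousOn
    hΨ.continuousOn
  refine Integrable.of_bound (hΨ.measurable.comp (hu.prodMk hv)).aestronglyMeasurable C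
    (Filter.Eventually.of_forall fun a => hC _ ?_)
  exact ⟨mem_closedBall_zero_iff.2 (hcu a), mem_closedBall_zero_iff.2 (hcv a)⟩

/-- Averaging over a geometric level a bound that involves only the levels `1, …, K`. -/
theorem integral_geometric_le {ν : Measure ℕ} [IsProbabilityMeasure ν]
    (hν : ∀ j, 1 ≤ j → ν {j} = (1 / 2) ^ j) {a w : ℕ → ℝ} (ha : ∀ m, 0 ≤ a m) {c : ℝ} {K : ℕ}
    (h : ∀ m, a m ≤ c + if m ∈ Finset.Icc 1 K then w m else 0) :
    ∫ m, a m ∂ν ≤ c + ∑ m ∈ Finset.Icc 1 K, (1 / 2) ^ m * w m := by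
  have hind : (fun m => if m ∈ Finset.Icc 1 K then w m else 0)
      = fun m => ∑ k ∈ Finset.Icc 1 K, ({k} : Set ℕ).indicator (fun _ => w k) m := by
    funext m
    simp only [Set.indicator_apply, Set.mem_singleton_iff]
    rw [Finset.sum_ite_eq]
  have hii : ∀ k, Integrable (({k} : Set ℕ).indicator fun _ => w k) ν := fun k =>
    (integrable_const _).indicator (measurableSet_singleton k)
  have hi : Integrable (fun m => if m ∈ Finset.Icc 1 K then w m else 0) ν := by
    rw [hind]; exact integrable_finsetSum _ fun k _ => hii k
  have hi' : Integrable (fun m => c + if m ∈ Finset.Icc 1 K then w m else 0) ν :=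
    (integrable_const c).add hi
  have hai : Integrable a ν := hi'.mono' measurable_from_nat.aestronglyMeasurable
    (Filter.Eventually.of_forall fun m => by rw [Real.norm_of_nonneg (ha m)]; exact h m)
  refine (integral_mono hai hi' h).trans (le_of_eq ?_)
  rw [integral_add (integrable_const c) hi, hind, integral_finsetSum _ fun k _ => hii k]
  simp only [integral_const, probReal_univ, one_smul]
  congr 1
  refine Finset.sum_congr rfl fun k hk => ?_
  -- Only levels at least 1 carry a weight, so the mass at 0 is never needed.
  rw [integral_indicator_const _ (measurableSet_singleton k), measureReal_def,
    hν k (Finset.mem_Icc.1 hk).1]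
  simp

/-- At level 0 truncated subtraction makes the correction g_0 - g_0 = 0, so excluding that level
changes nothing. -/
theorem mlmcGrad_eq_ite {d : ℕ} {S : Type*} (F : EuclideanSpace ℝ (Fin d) → S → ℝ) (z : ℕ → S)
    {M : ℝ} (B T m : ℕ) (x : EuclideanSpace ℝ (Fin d)) {K : ℕ}
    (hK : ∀ m : ℕ, (2 : ℝ) ^ m ≤ M ↔ m ≤ K) :
    mlmcGrad F z M B T m x = batchGrad F z B T 0 x + if m ∈ Finset.Icc 1 K then
      (2 : ℝ) ^ m • (batchGrad F z B T m x - batchGrad F z B T (m - 1) x) else 0 := by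
  rw [mlmcGrad]
  rcases Nat.eq_zero_or_pos m with rfl | hm
  · simp
  · simp only [hK, Finset.mem_Icc, Nat.succ_le_of_lt hm, true_and]

/-- Summation of the level errors: the mean squared errors decay like `2^{-m}` and the biases
telescope. -/
theorem sum_levels_le {s t : ℕ → ℝ} {Sc a : ℝ} (ha : 0 ≤ a) (hs : ∀ m, s m ≤ Sc / 2 ^ m) (K : ℕ) :
    4 * a * s 0 + t 0 + ∑ m ∈ Finset.Icc 1 K, (1 / 2) ^ m *
        (2 * a * (4 * 4 ^ m * (s m + s (m - 1))) + 2 ^ m * (t m - t (m - 1)))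
      ≤ 2 * a * ((2 + 12 * K) * Sc) + t K := by
  induction K with
  | zero =>
    have := hs 0
    simp only [pow_zero, div_one] at this
    have := mul_le_mul_of_nonneg_left this (show 0 ≤ 4 * a by positivity)
    simp
    linarith
  | succ K ih =>
    rw [Finset.sum_Icc_succ_top (by omega), Nat.add_sub_cancel]
    have h4 : (4 : ℝ) ^ (K + 1) = 2 ^ (K + 1) * 2 ^ (K + 1) := by
      rw [← mul_pow]; norm_num
    have h2 : (0 : ℝ) < 2 ^ (K + 1) := by positivity
    have h2' : (0 : ℝ) < 2 ^ K := by positivity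
    -- The probability reduces 4^m to 2^m, which the decay of s compensates, and removes 2^m from
    -- the bias difference.
    have e1 : (1 / 2 : ℝ) ^ (K + 1) * (2 * a * (4 * 4 ^ (K + 1) * (s (K + 1) + s K))
          + 2 ^ (K + 1) * (t (K + 1) - t K))
        = 8 * a * (2 ^ (K + 1) * s (K + 1) + 2 * (2 ^ K * s K)) + (t (K + 1) - t K) := by
      rw [h4, div_pow, one_pow]
      field_simp
      ring
    have f1 : 2 ^ (K + 1) * s (K + 1) ≤ Sc := by
      have := hs (K + 1); rw [le_div_iff₀ h2] at this; linarith
    have f2 : 2 ^ K * s K ≤ Sc := by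
      have := hs K; rw [le_div_iff₀ h2'] at this; linarith
    have f3 := mul_le_mul_of_nonneg_left (show 2 ^ (K + 1) * s (K + 1) + 2 * (2 ^ K * s K) ≤ 3 * Sc
      by linarith) (show 0 ≤ 8 * a by positivity)
    rw [e1]
    push_cast
    linarith

/-! ### Expected potential after one step -/

section Step

variable {d : ℕ} {S Ω : Type*} [MeasurableSpace S] [MeasurableSpace Ω]
  {F : EuclideanSpace ℝ (Fin d) → S → ℝ} {f : EuclideanSpace ℝ (Fin d) → ℝ} {π : Measure S}
  {σ δ L μ γ p β η θ M : ℝ} {Z : ℕ → Ω → S} {Q : Kernel S S} [IsMarkovKernel Q] {P : Measure Ω}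
  [IsProbabilityMeasure P] {τ : ℕ}

/-- Average over the level and the noise of the potential after one step from a state determined by
the past. -/
theorem IsGradientOracle.integral_accStep_le (h : IsGradientOracle F f π σ δ)
    (hZ : IsMarkovChain Z Q π P) (hQ : IsUniformlyGeometricallyErgodic Q π τ)
    (hL : IsLSmooth f L) (hμ : IsStronglyConvex f μ) (hpar : IsAccParam μ γ p β η θ)
    {xs : EuclideanSpace ℝ (Fin d)} (hxs : ∀ y, f xs ≤ f y) {B : ℕ} (hB : 0 < B) {K : ℕ}
    (hK : ∀ m : ℕ, (2 : ℝ) ^ m ≤ M ↔ m ≤ K) {ν : Measure ℕ} [IsProbabilityMeasure ν]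
    (hν : ∀ j, 1 ≤ j → ν {j} = (1 / 2) ^ j) {A D : ℝ}
    (ha : 2 * (p * (1 + 2 * γ * L)) * (1 + (2 + 12 * K) * (16 / 3 * τ / B) * δ ^ 2) ≤ 3 / 2)
    (haV : 2 * (p * (1 + 2 * γ * L)) * ((2 + 12 * K) * (16 / 3 * τ / B)) ≤ A)
    (hD : (4 + 2 * p / β) * (8 / 3 * τ / (2 ^ K * B)) ^ 2 ≤ D) (hDδ : D * δ ^ 2 ≤ 1 / 4)
    {T : ℕ} {X Xf : (ℕ → S) → EuclideanSpace ℝ (Fin d)} (hXm : Measurable X) (hXfm : Measurable Xf)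
    {c : ℝ} (hX : ∀ z, ‖X z‖ ≤ c) (hXf : ∀ z, ‖Xf z‖ ≤ c) (hXT : DependsOn X (Set.Iic T))
    (hXfT : DependsOn Xf (Set.Iic T)) :
    ∫ m, ∫ z, accPotential f μ xs
        (accStep F γ p β η θ M B z m { x := X z, xf := Xf z, T := T }) ∂(pathLaw Z P) ∂ν
      ≤ (1 - β / 2) * ∫ z, accPotential f μ xs { x := X z, xf := Xf z, T := T } ∂(pathLaw Z P)
        + 3 * p * γ / μ * (A + D) * σ ^ 2 := by
  have := hZ.isProbabilityMeasure_pathLaw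
  have hμ0 := hpar.mu_pos
  have hβ0 := hpar.beta_pos
  have hγ0 := hpar.gamma_pos
  have hp0 := hpar.p_pos
  have hL0 := hL.pos
  set κ := 3 * p * γ / μ with hκ
  have hκ0 : 0 < κ := by positivity
  set a := κ * (p * (1 + 2 * γ * L)) with hadef
  have ha0 : 0 ≤ a := by positivity
  -- The point x_g, the point y, the vector W tested against the error, and the error-free part of
  -- the step are written as continuous functions of (x, x_f), which yields measurability and bounds
  -- at once.
  let gl : EuclideanSpace ℝ (Fin d) × EuclideanSpace ℝ (Fin d) → EuclideanSpace ℝ (Fin d) :=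
    fun q => θ • q.2 + (1 - θ) • q.1
  let yl : EuclideanSpace ℝ (Fin d) × EuclideanSpace ℝ (Fin d) → EuclideanSpace ℝ (Fin d) :=
    fun q => (1 - β) • q.1 + β • gl q
  let Wl : EuclideanSpace ℝ (Fin d) × EuclideanSpace ℝ (Fin d) → EuclideanSpace ℝ (Fin d) :=
    fun q => -((2 * κ) • gradient f (gl q) + (3 * β / μ) • (yl q - xs))
  let base : EuclideanSpace ℝ (Fin d) × EuclideanSpace ℝ (Fin d) → ℝ := fun q =>
    (1 - β) * ‖q.1 - xs‖ ^ 2 + (1 - β / 2) * (6 / μ * (f q.2 - f xs)) - β / 2 * ‖gl q - xs‖ ^ 2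
      + (2 * a - 2 * κ) * ‖gradient f (gl q)‖ ^ 2
  have hglc : Continuous gl := by fun_prop
  have hylc : Continuous yl := by fun_prop
  have hgradc : Continuous fun q => gradient f (gl q) := h.continuous_gradient.comp hglc
  have hWc : Continuous Wl := by fun_prop
  have hfc := h.continuous
  have hnc : Continuous fun q => noiseLevel f σ δ (gl q) := h.continuous_noiseLevel.comp hglc
  have hbasec : Continuous base := by fun_prop
  have hXX : Measurable fun z => (X z, Xf z) := hXm.prodMk hXfm
  have hint : ∀ {Ψ : EuclideanSpace ℝ (Fin d) × EuclideanSpace ℝ (Fin d) → ℝ}, Continuous Ψ →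
      Integrable (fun z => Ψ (X z, Xf z)) (pathLaw Z P) := fun hΨ =>
    integrable_continuous_comp hXm hXfm hX hXf hΨ
  have hbdd : ∀ {V : Type} [NormedAddCommGroup V]
      {Ψ : EuclideanSpace ℝ (Fin d) × EuclideanSpace ℝ (Fin d) → V}, Continuous Ψ →
      ∃ C, ∀ z, ‖Ψ (X z, Xf z)‖ ≤ C := by
    intro V _ Ψ hΨ
    obtain ⟨C, hC⟩ := ((isCompact_closedBall (0 : EuclideanSpace ℝ (Fin d)) c).prod
      (isCompact_closedBall (0 : EuclideanSpace ℝ (Fin d)) c)).exists_bound_of_continuousOn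
      hΨ.continuousOn
    exact ⟨C, fun z => hC _ ⟨mem_closedBall_zero_iff.2 (hX z), mem_closedBall_zero_iff.2 (hXf z)⟩⟩
  have hdep : ∀ {V : Type} {Ψ : EuclideanSpace ℝ (Fin d) × EuclideanSpace ℝ (Fin d) → V},
      DependsOn (fun z => Ψ (X z, Xf z)) (Set.Iic T) := fun {V Ψ} z z' e => by
    simp only [hXT e, hXfT e]
  obtain ⟨cg, hcg⟩ := hbdd hglc
  obtain ⟨cW, hcW⟩ := hbdd hWc
  obtain ⟨cn, hcn⟩ := hbdd hgradc
  obtain ⟨cb, -, hcb⟩ := h.exists_batchGrad_bound B cg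
  have hgm : Measurable fun z => gl (X z, Xf z) := hglc.measurable.comp hXX
  have hWm : Measurable fun z => Wl (X z, Xf z) := hWc.measurable.comp hXX
  let e : ℕ → (ℕ → S) → EuclideanSpace ℝ (Fin d) := fun m z =>
    batchGrad F z B T m (gl (X z, Xf z)) - gradient f (gl (X z, Xf z))
  have hem : ∀ m, Measurable (e m) := fun m =>
    ((h.measurable_batchGrad B T m).comp (hgm.prodMk measurable_id)).sub
      (hgradc.measurable.comp hXX)
  have heb : ∀ m z, ‖e m z‖ ≤ cb + cn := fun m z =>
    norm_sub_le_of_le (hcb _ _ _ _ (hcg z)) (hcn z)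
  have hei : ∀ m, Integrable (fun z => ‖e m z‖ ^ 2) (pathLaw Z P) := fun m =>
    integrable_continuous_comp (hem m) (hem m) (heb m) (heb m)
      (Ψ := fun q => ‖q.1‖ ^ 2) (by fun_prop)
  have hWi : ∀ m, Integrable (fun z => inner ℝ (Wl (X z, Xf z)) (e m z)) (pathLaw Z P) := fun m =>
    integrable_continuous_comp hWm (hem m) hcW (heb m)
      (Ψ := fun q => inner ℝ q.1 q.2) (by fun_prop)
  let s : ℕ → ℝ := fun m => ∫ z, ‖e m z‖ ^ 2 ∂(pathLaw Z P)
  let t : ℕ → ℝ := fun m => ∫ z, inner ℝ (Wl (X z, Xf z)) (e m z) ∂(pathLaw Z P)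
  have hpot : ∀ m z, accPotential f μ xs
      (accStep F γ p β η θ M B z m { x := X z, xf := Xf z, T := T })
      ≤ base (X z, Xf z) + (4 * a * ‖e 0 z‖ ^ 2 + inner ℝ (Wl (X z, Xf z)) (e 0 z)
        + if m ∈ Finset.Icc 1 K then
          2 * a * (4 * 4 ^ m * (‖e m z‖ ^ 2 + ‖e (m - 1) z‖ ^ 2))
            + 2 ^ m * (inner ℝ (Wl (X z, Xf z)) (e m z) - inner ℝ (Wl (X z, Xf z)) (e (m - 1) z))
          else 0) := by
    intro m z
    set er := mlmcGrad F z M B T m (gl (X z, Xf z)) - gradient f (gl (X z, Xf z)) with her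
    have hstep := hpar.potential_step_le hL hμ xs (X z) (Xf z) er _ _ rfl rfl
    have hgr : gradient f (gl (X z, Xf z)) + er = mlmcGrad F z M B T m (gl (X z, Xf z)) := by
      rw [her]; abel
    change _ ≤ base (X z, Xf z) + 2 * a * ‖er‖ ^ 2 + inner ℝ (Wl (X z, Xf z)) er at hstep
    have hstep' : accPotential f μ xs
        (accStep F γ p β η θ M B z m { x := X z, xf := Xf z, T := T })
        ≤ base (X z, Xf z) + 2 * a * ‖er‖ ^ 2 + inner ℝ (Wl (X z, Xf z)) er := by
      change _ + 6 / μ * (f (gl (X z, Xf z) - (p * γ) • (gradient f (gl (X z, Xf z)) + er)) - f xs)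
        ≤ _ at hstep
      refine le_trans (le_of_eq ?_) hstep
      change _ = ‖η • (gl (X z, Xf z) - (p * γ) • (gradient f (gl (X z, Xf z)) + er)) + _ + _ + _
        - xs‖ ^ 2 + _
      rw [hgr]
      rfl
    refine hstep'.trans ?_
    -- The true gradient cancels in level differences, so the error of the estimator is the same
    -- combination of batch errors.
    have herr : er = e 0 z + if m ∈ Finset.Icc 1 K then (2 : ℝ) ^ m • (e m z - e (m - 1) z)
        else 0 := by
      rw [her, mlmcGrad_eq_ite F z B T m _ hK]
      simp only [e, sub_sub_sub_cancel_right]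
      abel
    rw [herr]
    split_ifs
    · rw [inner_add_right, inner_smul_right, inner_sub_right _ (e m z) (e (m - 1) z)]
      have n1 : ‖e 0 z + (2 : ℝ) ^ m • (e m z - e (m - 1) z)‖ ^ 2
          ≤ 2 * ‖e 0 z‖ ^ 2 + 4 * 4 ^ m * (‖e m z‖ ^ 2 + ‖e (m - 1) z‖ ^ 2) := by
        have b1 : ∀ v w : EuclideanSpace ℝ (Fin d), ‖v + w‖ ^ 2 ≤ 2 * ‖v‖ ^ 2 + 2 * ‖w‖ ^ 2 :=
          fun v w => by
            nlinarith [norm_add_le v w, norm_nonneg (v + w), sq_nonneg (‖v‖ - ‖w‖), norm_nonneg v,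
              norm_nonneg w]
        have b2 := b1 (e 0 z) ((2 : ℝ) ^ m • (e m z - e (m - 1) z))
        have b3 := b1 (e m z) (-e (m - 1) z)
        rw [← sub_eq_add_neg, norm_neg] at b3
        rw [norm_smul, Real.norm_of_nonneg (by positivity), mul_pow, ← pow_mul, mul_comm m 2,
          pow_mul, show (2 : ℝ) ^ 2 = 4 by norm_num] at b2
        have b4 := mul_le_mul_of_nonneg_left b3 (show (0 : ℝ) ≤ 4 ^ m by positivity)
        linarith
      have n2 := mul_le_mul_of_nonneg_left n1 (show 0 ≤ 2 * a by positivity)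
      linarith
    · rw [add_zero, add_zero]
      have : 0 ≤ a * ‖e 0 z‖ ^ 2 := by positivity
      linarith
  have hlev : ∀ m, ∫ z, accPotential f μ xs
        (accStep F γ p β η θ M B z m { x := X z, xf := Xf z, T := T }) ∂(pathLaw Z P)
      ≤ (∫ z, base (X z, Xf z) ∂(pathLaw Z P) + (4 * a * s 0 + t 0))
        + if m ∈ Finset.Icc 1 K then
          2 * a * (4 * 4 ^ m * (s m + s (m - 1))) + 2 ^ m * (t m - t (m - 1)) else 0 := by
    intro m
    have i0 : Integrable (fun z => 4 * a * ‖e 0 z‖ ^ 2 + inner ℝ (Wl (X z, Xf z)) (e 0 z))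
        (pathLaw Z P) := ((hei 0).const_mul (4 * a)).add (hWi 0)
    have j0 : ∫ z, (4 * a * ‖e 0 z‖ ^ 2 + inner ℝ (Wl (X z, Xf z)) (e 0 z)) ∂(pathLaw Z P)
        = 4 * a * s 0 + t 0 := by
      rw [integral_add ((hei 0).const_mul (4 * a)) (hWi 0), integral_const_mul]
    have hp := hpot m
    split_ifs at hp ⊢ with hm
    · have i1 : Integrable (fun z => 2 * a * (4 * 4 ^ m * (‖e m z‖ ^ 2 + ‖e (m - 1) z‖ ^ 2)))
          (pathLaw Z P) := (((hei m).add (hei (m - 1))).const_mul (4 * 4 ^ m)).const_mul (2 * a)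
      have i2 : Integrable (fun z => (2 : ℝ) ^ m * (inner ℝ (Wl (X z, Xf z)) (e m z)
          - inner ℝ (Wl (X z, Xf z)) (e (m - 1) z))) (pathLaw Z P) :=
        ((hWi m).sub (hWi (m - 1))).const_mul _
      have key := integral_mono_of_nonneg
        (Filter.Eventually.of_forall fun z => accPotential_nonneg hμ0 hxs _)
        ((hint hbasec).add (i0.add (i1.add i2))) (Filter.Eventually.of_forall hp)
      refine key.trans (le_of_eq ?_)
      rw [integral_add' (hint hbasec) (i0.add (i1.add i2)), integral_add' i0 (i1.add i2),
        integral_add' i1 i2, j0, integral_const_mul, integral_const_mul, integral_const_mul,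
        integral_add (hei m) (hei (m - 1)), integral_sub (hWi m) (hWi (m - 1))]
      ring
    · simp only [add_zero] at hp ⊢
      have key := integral_mono_of_nonneg
        (Filter.Eventually.of_forall fun z => accPotential_nonneg hμ0 hxs _)
        ((hint hbasec).add i0) (Filter.Eventually.of_forall hp)
      refine key.trans (le_of_eq ?_)
      rw [integral_add' (hint hbasec) i0, j0]
  have havg := integral_geometric_le hν (fun m => integral_nonneg fun z =>
    accPotential_nonneg hμ0 hxs _) hlev
  have hR2i : Integrable (fun z => noiseLevel f σ δ (gl (X z, Xf z)) ^ 2) (pathLaw Z P) :=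
    hint (hnc.pow 2)
  have hWRi : Integrable (fun z => ‖Wl (X z, Xf z)‖ * noiseLevel f σ δ (gl (X z, Xf z)))
      (pathLaw Z P) := hint (hWc.norm.mul hnc)
  have hs : ∀ m, s m ≤ 16 / 3 * τ / B
      * (∫ z, noiseLevel f σ δ (gl (X z, Xf z)) ^ 2 ∂(pathLaw Z P)) / 2 ^ m := by
    intro m
    refine (h.integral_norm_sq_batchGrad_sub_le hZ hQ hB m hgm hcg hdep).trans (le_of_eq ?_)
    field_simp
  -- After telescoping only the bias of the finest level `K` remains.
  have ht := h.integral_inner_batchGrad_sub_le hZ hQ hB K hgm hcg hdep hWm hcW hdep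
  have hsum := sum_levels_le (t := t) ha0 hs K
  have htot : ∫ m, ∫ z, accPotential f μ xs
        (accStep F γ p β η θ M B z m { x := X z, xf := Xf z, T := T }) ∂(pathLaw Z P) ∂ν
      ≤ ∫ z, (base (X z, Xf z)
        + 2 * a * ((2 + 12 * K) * (16 / 3 * τ / B) * noiseLevel f σ δ (gl (X z, Xf z)) ^ 2)
        + 8 / 3 * τ / (2 ^ K * B) * (‖Wl (X z, Xf z)‖ * noiseLevel f σ δ (gl (X z, Xf z))))
        ∂(pathLaw Z P) := by
    have hbR : Integrable (fun z => base (X z, Xf z) + 2 * a * ((2 + 12 * K) * (16 / 3 * τ / B)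
        * noiseLevel f σ δ (gl (X z, Xf z)) ^ 2)) (pathLaw Z P) :=
      (hint hbasec).add ((hR2i.const_mul _).const_mul _)
    rw [integral_add hbR (hWRi.const_mul _),
      integral_add (hint hbasec) ((hR2i.const_mul _).const_mul _), integral_const_mul,
      integral_const_mul, integral_const_mul]
    change t K ≤ _ at ht
    linarith
  have hpoti : Integrable (fun z => accPotential f μ xs { x := X z, xf := Xf z, T := T })
      (pathLaw Z P) := hint (Ψ := fun q => ‖q.1 - xs‖ ^ 2 + 6 / μ * (f q.2 - f xs)) (by fun_prop)
  refine htot.trans ?_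
  have hfin : ∫ z, ((1 - β / 2) * accPotential f μ xs { x := X z, xf := Xf z, T := T }
        + κ * (A + D) * σ ^ 2) ∂(pathLaw Z P)
      = (1 - β / 2) * ∫ z, accPotential f μ xs { x := X z, xf := Xf z, T := T } ∂(pathLaw Z P)
        + κ * (A + D) * σ ^ 2 := by
    rw [integral_add (hpoti.const_mul _) (integrable_const _), integral_const_mul]
    simp
  rw [← hfin]
  refine integral_mono (((hint hbasec).add ((hR2i.const_mul _).const_mul _)).add
    (hWRi.const_mul _)) ((hpoti.const_mul _).add (integrable_const _)) fun z => ?_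
  refine contraction_of_bounds (Y := ‖yl (X z, Xf z) - xs‖) (δ := δ) (q := 2 * p / β) hμ0 hβ0
    hpar.beta_le hκ0 (by positivity) (sq_nonneg ‖gl (X z, Xf z) - xs‖) (noiseLevel_nonneg _ _ _ _)
    (by positivity) (noiseLevel_sq _ _ _ _) ?_ ?_ ?_ ?_ ?_ hD hDδ
  · simp only [Wl, norm_neg]
    refine norm_add_le_of_le ?_ ?_ <;>
    · rw [norm_smul, Real.norm_of_nonneg (by positivity)]
  · have h1 : yl (X z, Xf z) - xs = (1 - β) • (X z - xs) + β • (gl (X z, Xf z) - xs) := by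
      simp only [yl]; module
    have h2 : ‖yl (X z, Xf z) - xs‖ ≤ (1 - β) * ‖X z - xs‖ + β * ‖gl (X z, Xf z) - xs‖ := by
      rw [h1]
      refine norm_add_le_of_le ?_ ?_
      · rw [norm_smul, Real.norm_of_nonneg (by linarith [hpar.beta_le])]
      · rw [norm_smul, Real.norm_of_nonneg hβ0.le]
    refine (pow_le_pow_left₀ (norm_nonneg _) h2 2).trans ?_
    nlinarith [mul_nonneg (mul_nonneg hβ0.le (sub_nonneg.2 hpar.beta_le))
      (sq_nonneg (‖X z - xs‖ - ‖gl (X z, Xf z) - xs‖))]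
  · have := hpar.sq_eq
    calc 9 * β / (2 * μ ^ 2) = 6 / (μ * β) * (3 * β ^ 2 / (4 * μ)) := by field_simp; ring
      _ = κ * (2 * p / β) := by rw [← this, hκ]; field_simp; ring
  · have := mul_le_mul_of_nonneg_left ha hκ0.le
    rw [hadef]; linarith
  · have := mul_le_mul_of_nonneg_left haV hκ0.le
    rw [hadef]; linarith

end Step

/-! ### Freezing the levels and the recursion -/

/-- For independent `J_0, J_1, …`, a function of `J_0, …, J_k` may be averaged over `J_k` first. -/
theorem integral_eq_integral_integral_update {Ω : Type*} [MeasurableSpace Ω] {J : ℕ → Ω → ℕ}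
    {P : Measure Ω} [IsProbabilityMeasure P] (hJm : ∀ k, Measurable (J k)) (hJ : iIndepFun J P)
    {k : ℕ} {g : (ℕ → ℕ) → ℝ} (hg : Measurable g) (hgi : Integrable (fun ω => g fun i => J i ω) P)
    (hk : DependsOn g (Set.Iic k)) :
    ∫ ω, g (fun i => J i ω) ∂P
      = ∫ ω, ∫ m, g (Function.update (fun i => J i ω) k m) ∂(P.map (J k)) ∂P := by
  let H : Ω → (Finset.range k → ℕ) := fun ω i => J i ω
  have hH : Measurable H := measurable_pi_lambda _ fun i => hJm i
  have hind : IndepFun H (J k) P :=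
    (hJ.indepFun_finset (Finset.range k) {k} (by simp) hJm).comp measurable_id
      (measurable_pi_apply (⟨k, Finset.mem_singleton_self k⟩ : ({k} : Finset ℕ)))
  have hmap := (indepFun_iff_map_prod_eq_prod_map_map hH.aemeasurable
    (hJm k).aemeasurable).1 hind
  let ext : (Finset.range k → ℕ) × ℕ → ℕ → ℕ := fun q n =>
    if n = k then q.2 else if hn : n ∈ Finset.range k then q.1 ⟨n, hn⟩ else 0
  have hext : Measurable ext := by
    refine measurable_pi_lambda _ fun n => ?_
    simp only [ext]
    split_ifs
    · exact measurable_snd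
    · exact (measurable_pi_apply _).comp measurable_fst
    · exact measurable_const
  have hup : ∀ ω m, g (Function.update (fun i => J i ω) k m) = g (ext (H ω, m)) := by
    intro ω m
    refine hk fun i hi => ?_
    by_cases h : i = k
    · subst h; simp [ext]
    · have : i < k := lt_of_le_of_ne hi h
      simp [ext, h, this, H]
  have hself : ∀ ω, g (fun i => J i ω) = g (ext (H ω, J k ω)) := fun ω => by
    rw [← hup, show J k ω = (fun i => J i ω) k from rfl, Function.update_eq_self]
  have hHJ : Measurable fun ω => (H ω, J k ω) := hH.prodMk (hJm k)
  have hgm : Measurable fun q => g (ext q) := hg.comp hext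
  simp only [hup]
  simp only [hself] at hgi ⊢
  have hgi' : Integrable (fun q => g (ext q)) ((P.map H).prod (P.map (J k))) := by
    rw [← hmap]
    exact (integrable_map_measure hgm.aestronglyMeasurable hHJ.aemeasurable).2 hgi
  have := Measure.isProbabilityMeasure_map (μ := P) (hJm k).aemeasurable
  have := Measure.isProbabilityMeasure_map (μ := P) hH.aemeasurable
  rw [← integral_map hHJ.aemeasurable (f := fun q => g (ext q)) hgm.aestronglyMeasurable, hmap,
    integral_prod _ hgi', integral_map hH.aemeasurable]
  exact hgm.stronglyMeasurable.integral_prod_right.aestronglyMeasurable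

section Recursion

variable {d : ℕ} {S Ω : Type*} [MeasurableSpace S] [MeasurableSpace Ω]
  {F : EuclideanSpace ℝ (Fin d) → S → ℝ} {f : EuclideanSpace ℝ (Fin d) → ℝ} {π : Measure S}
  {σ δ L μ γ p β η θ M : ℝ} {Z : ℕ → Ω → S} {J : ℕ → Ω → ℕ} {P : Measure Ω}
  [IsProbabilityMeasure P] {τ B : ℕ} {x₀ xs : EuclideanSpace ℝ (Fin d)}

theorem IsGradientOracle.integrable_accPotential (h : IsGradientOracle F f π σ δ)
    (m : Measure ((ℕ → ℕ) × (ℕ → S))) [IsFiniteMeasure m] (k : ℕ) :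
    Integrable (fun q => accPotential f μ xs (accIterate F γ p β η θ M B x₀ q.2 q.1 k)) m := by
  obtain ⟨c, hc⟩ := h.exists_accIterate_bound (γ := γ) (p := p) (β := β) (η := η) (θ := θ) (M := M)
    (B := B) (x₀ := x₀) k
  have hfc := h.continuous
  exact integrable_continuous_comp (h.measurable_accIterate k).1 (h.measurable_accIterate k).2
    (fun q => (hc q.2 q.1).1) (fun q => (hc q.2 q.1).2)
    (Ψ := fun q => ‖q.1 - xs‖ ^ 2 + 6 / μ * (f q.2 - f xs)) (by fun_prop)

theorem IsGradientOracle.measurable_accPotential (h : IsGradientOracle F f π σ δ) (k : ℕ) :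
    Measurable fun q : (ℕ → ℕ) × (ℕ → S) =>
      accPotential f μ xs (accIterate F γ p β η θ M B x₀ q.2 q.1 k) := by
  have hf := h.continuous.measurable
  have hm := h.measurable_accIterate (γ := γ) (p := p) (β := β) (η := η) (θ := θ) (M := M) (B := B)
    (x₀ := x₀) k
  exact ((hm.1.sub_const xs).norm.pow_const 2).add
    (((hf.comp hm.2).sub_const (f xs)).const_mul (6 / μ))

/-- One step of the recursion for the expected potential. -/
theorem IsGradientOracle.integral_accPotential_succ_le {Q : Kernel S S} [IsMarkovKernel Q]
    (h : IsGradientOracle F f π σ δ)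
    (hZ : IsMarkovChain Z Q π P) (hQ : IsUniformlyGeometricallyErgodic Q π τ)
    (hJ : IsIIDGeometricHalf J P)
    (hL : IsLSmooth f L) (hμ : IsStronglyConvex f μ) (hpar : IsAccParam μ γ p β η θ)
    (hxs : ∀ y, f xs ≤ f y) (hB : 0 < B) {K : ℕ}
    (hK : ∀ m : ℕ, (2 : ℝ) ^ m ≤ M ↔ m ≤ K) {A D : ℝ}
    (ha : 2 * (p * (1 + 2 * γ * L)) * (1 + (2 + 12 * K) * (16 / 3 * τ / B) * δ ^ 2) ≤ 3 / 2)
    (haV : 2 * (p * (1 + 2 * γ * L)) * ((2 + 12 * K) * (16 / 3 * τ / B)) ≤ A)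
    (hD : (4 + 2 * p / β) * (8 / 3 * τ / (2 ^ K * B)) ^ 2 ≤ D) (hDδ : D * δ ^ 2 ≤ 1 / 4) (k : ℕ) :
    ∫ q, accPotential f μ xs (accIterate F γ p β η θ M B x₀ q.2 q.1 (k + 1))
        ∂((pathLaw J P).prod (pathLaw Z P))
      ≤ (1 - β / 2) * ∫ q, accPotential f μ xs (accIterate F γ p β η θ M B x₀ q.2 q.1 k)
        ∂((pathLaw J P).prod (pathLaw Z P)) + 3 * p * γ / μ * (A + D) * σ ^ 2 := by
  have hJm : Measurable fun ω i => J i ω := measurable_pi_lambda _ hJ.measurable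
  have := hZ.isProbabilityMeasure_pathLaw
  have : IsProbabilityMeasure (pathLaw J P) := Measure.isProbabilityMeasure_map hJm.aemeasurable
  have : IsProbabilityMeasure (P.map (J k)) :=
    Measure.isProbabilityMeasure_map (hJ.measurable k).aemeasurable
  have hν : ∀ j, 1 ≤ j → P.map (J k) {j} = (1 / 2) ^ j := fun j hj => by
    rw [Measure.map_apply (hJ.measurable k) (measurableSet_singleton j), ← hJ.law k j hj]
    rfl
  have hfub : ∀ k, ∫ q, accPotential f μ xs (accIterate F γ p β η θ M B x₀ q.2 q.1 k)
        ∂((pathLaw J P).prod (pathLaw Z P))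
      = ∫ ω, ∫ z, accPotential f μ xs (accIterate F γ p β η θ M B x₀ z (fun i => J i ω) k)
        ∂(pathLaw Z P) ∂P := by
    intro k
    rw [integral_prod _ (h.integrable_accPotential _ k)]
    conv_lhs => rw [pathLaw]
    rw [integral_map hJm.aemeasurable]
    exact (h.measurable_accPotential k).stronglyMeasurable.integral_prod_right.aestronglyMeasurable
  have hInt : ∀ k, Integrable (fun ω => ∫ z, accPotential f μ xs
      (accIterate F γ p β η θ M B x₀ z (fun i => J i ω) k) ∂(pathLaw Z P)) P := fun k =>
    (h.integrable_accPotential ((pathLaw J P).prod (pathLaw Z P)) k).integral_prod_left.comp_measurable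
      hJm
  rw [hfub, hfub]
  have hdep : DependsOn (fun j : ℕ → ℕ => ∫ z, accPotential f μ xs
      (accIterate F γ p β η θ M B x₀ z j (k + 1)) ∂(pathLaw Z P)) (Set.Iic k) := by
    intro j j' e
    have : ∀ z, accIterate F γ p β η θ M B x₀ z j (k + 1)
        = accIterate F γ p β η θ M B x₀ z j' (k + 1) := fun z =>
      accIterate_congr (fun i hi => e i (Nat.lt_succ_iff.1 hi)) fun _ _ => rfl
    simp only [this]
  rw [integral_eq_integral_integral_update hJ.measurable hJ.independent
    (g := fun j => ∫ z, accPotential f μ xs (accIterate F γ p β η θ M B x₀ z j (k + 1))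
      ∂(pathLaw Z P))
    (h.measurable_accPotential (k + 1)).stronglyMeasurable.integral_prod_right.measurable
    (hInt (k + 1)) hdep]
  obtain ⟨c, hc⟩ := h.exists_accIterate_bound (γ := γ) (p := p) (β := β) (η := η) (θ := θ) (M := M)
    (B := B) (x₀ := x₀) k
  have hm := h.measurable_accIterate (γ := γ) (p := p) (β := β) (η := η) (θ := θ) (M := M) (B := B)
    (x₀ := x₀) k
  have hstep : ∀ j : ℕ → ℕ, ∫ m, ∫ z, accPotential f μ xs
        (accIterate F γ p β η θ M B x₀ z (Function.update j k m) (k + 1)) ∂(pathLaw Z P)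
        ∂(P.map (J k))
      ≤ (1 - β / 2) * ∫ z, accPotential f μ xs (accIterate F γ p β η θ M B x₀ z j k) ∂(pathLaw Z P)
        + 3 * p * γ / μ * (A + D) * σ ^ 2 := by
    intro j
    -- With `j` frozen the sample counter is this number, and the state depends on the noise only up
    -- to it, as the one-step bound requires.
    set T := ∑ i ∈ Finset.range k, 2 ^ j i * B with hT
    have hst : ∀ z, accIterate F γ p β η θ M B x₀ z j k
        = { x := (accIterate F γ p β η θ M B x₀ z j k).x
            xf := (accIterate F γ p β η θ M B x₀ z j k).xf
            T := T } := fun z => by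
      rw [hT, ← accIterate_T (F := F) (γ := γ) (p := p) (β := β) (η := η) (θ := θ) (M := M)
        (x₀ := x₀) z j k]
    have hsucc : ∀ m z, accIterate F γ p β η θ M B x₀ z (Function.update j k m) (k + 1)
        = accStep F γ p β η θ M B z m
          { x := (accIterate F γ p β η θ M B x₀ z j k).x
            xf := (accIterate F γ p β η θ M B x₀ z j k).xf
            T := T } := fun m z => by
      rw [← hst, accIterate, Function.update_self]
      congr 1
      exact accIterate_congr (fun i hi => Function.update_of_ne hi.ne _ _) fun _ _ => rfl
    have hdepT : DependsOn (fun z : ℕ → S => accIterate F γ p β η θ M B x₀ z j k) (Set.Iic T) :=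
      fun z z' e => accIterate_congr (fun _ _ => rfl) e
    have key := h.integral_accStep_le hZ hQ hL hμ hpar hxs hB hK hν ha haV hD hDδ
      (hm.1.comp measurable_prodMk_left) (hm.2.comp measurable_prodMk_left) (fun z => (hc z j).1)
      (fun z => (hc z j).2) (T := T) (fun z z' e => congrArg AccState.x (hdepT e))
      (fun z z' e => congrArg AccState.xf (hdepT e))
    simp only [hsucc]
    rw [show (fun z => accPotential f μ xs (accIterate F γ p β η θ M B x₀ z j k)) = fun z =>
      accPotential f μ xs { x := (accIterate F γ p β η θ M B x₀ z j k).x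
                            xf := (accIterate F γ p β η θ M B x₀ z j k).xf
                            T := T } from funext fun z => by rw [← hst]]
    exact key
  have hfin := integral_mono_of_nonneg (μ := P)
    (Filter.Eventually.of_forall fun ω => integral_nonneg fun m => integral_nonneg fun z =>
      accPotential_nonneg hpar.mu_pos hxs _)
    (((hInt k).const_mul (1 - β / 2)).add (integrable_const (3 * p * γ / μ * (A + D) * σ ^ 2)))
    (Filter.Eventually.of_forall fun ω => hstep fun i => J i ω)
  rw [integral_add' ((hInt k).const_mul (1 - β / 2)) (integrable_const _), integral_const_mul] at hfin
  simpa using hfin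

end Recursion

/-- c/r is the fixed point of the affine map that bounds one step. -/
theorem le_pow_mul_add_of_recursion {a : ℕ → ℝ} {r c : ℝ} (hr : 0 < r) (hr1 : r ≤ 1) (hc : 0 ≤ c)
    (h : ∀ k, a (k + 1) ≤ (1 - r) * a k + c) (n : ℕ) : a n ≤ (1 - r) ^ n * a 0 + c / r := by
  induction n with
  | zero => have : 0 ≤ c / r := by positivity
            simpa using this
  | succ n ih =>
    refine (h n).trans ?_
    have h1 := mul_le_mul_of_nonneg_left ih (sub_nonneg.2 hr1)
    have h2 : (1 - r) * (c / r) + c = c / r := by field_simp; ring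
    rw [pow_succ]
    linarith

/-! ### Numerical bounds on the parameters -/

section Parameters

variable {L μ σ δ γ p β η θ M : ℝ} {τ b B : ℕ}

theorem sixteen_le_constC1 : 16 ≤ constC1 := by
  rw [constC1]
  have : 0 ≤ 1 / Real.log 4 ^ 2 := by positivity
  linarith

/-- 224/3 = 14 · 16/3 is the mean-square constant of the multilevel estimator; ln² 4 ≤ 6 suffices.
-/
theorem batch_const_le_constC1 : 224 / 3 ≤ 4 * constC1 := by
  have h1 : Real.log 4 = 2 * Real.log 2 := by
    rw [show (4 : ℝ) = 2 ^ 2 by norm_num, Real.log_pow]; norm_num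
  have h2 := Real.log_two_lt_d9
  have h3 : 0 < Real.log 2 := Real.log_pos (by norm_num)
  have h4 : Real.log 4 ^ 2 ≤ 6 := by rw [h1]; nlinarith
  have h5 : 0 < Real.log 4 ^ 2 := by rw [h1]; positivity
  have h6 : 1 / 6 ≤ 1 / Real.log 4 ^ 2 := one_div_le_one_div_of_le h5 h4
  rw [constC1]
  linarith

/-- The square roots disappear through ηβ = 2p. The bound β ≤ 1 comes from p ≤ 1 and μγ ≤ Lγ ≤ 3/4.
-/
theorem isAccParam_of_eq (hμ : 0 < μ) (hμL : μ ≤ L) (hγ : 0 < γ) (hγL : γ ≤ 3 / (4 * L))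
    (hp : 0 < p) (hp1 : p ≤ 1) (hβ : β = Real.sqrt (4 * p ^ 2 * μ * γ / 3))
    (hη : η = Real.sqrt (3 / (μ * γ))) (hθ : θ = (p * η⁻¹ - 1) / (β * p * η⁻¹ - 1)) :
    IsAccParam μ γ p β η θ := by
  have hL : 0 < L := hμ.trans_le hμL
  have hβ2 : β ^ 2 = 4 * p ^ 2 * μ * γ / 3 := by rw [hβ]; exact Real.sq_sqrt (by positivity)
  have hβ0 : 0 < β := by rw [hβ]; exact Real.sqrt_pos.2 (by positivity)
  have hη0 : 0 < η := by rw [hη]; exact Real.sqrt_pos.2 (by positivity)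
  have hη2 : η ^ 2 = 3 / (μ * γ) := by rw [hη]; exact Real.sq_sqrt (by positivity)
  have hηβ : η * β = 2 * p := by
    have : (η * β) ^ 2 = (2 * p) ^ 2 := by rw [mul_pow, hη2, hβ2]; field_simp; ring
    exact (pow_left_inj₀ (by positivity) (by positivity) two_ne_zero).1 this
  have hμγ : μ * γ ≤ 3 / 4 := by
    have h1 : L * γ ≤ 3 / 4 := by
      have := mul_le_mul_of_nonneg_left hγL hL.le
      refine this.trans (le_of_eq ?_)
      field_simp
    exact (mul_le_mul_of_nonneg_right hμL hγ.le).trans h1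
  have hβ1 : β ≤ 1 := by
    have hp2 : p ^ 2 ≤ 1 := pow_le_one₀ hp.le hp1
    have : p ^ 2 * (μ * γ) ≤ 1 * (3 / 4) := mul_le_mul hp2 hμγ (by positivity) zero_le_one
    have : β ^ 2 ≤ 1 := by rw [hβ2]; linarith
    exact (sq_le_one_iff₀ hβ0.le).1 this
  have hpη : p * η⁻¹ = β / 2 := by
    rw [← div_eq_mul_inv, div_eq_div_iff hη0.ne' two_ne_zero]; linarith
  refine ⟨hμ, hγ, hp, hβ0, hβ1, ?_, ?_, ?_⟩
  · rw [eq_div_iff hβ0.ne', hηβ]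
  · rw [hβ2]; field_simp
  · rw [hθ, mul_assoc, hpη, ← neg_div_neg_eq]
    congr 1 <;> ring

theorem two_pow_le_iff_le_floor_logb (hM : 2 ≤ M) (m : ℕ) :
    (2 : ℝ) ^ m ≤ M ↔ m ≤ ⌊Real.logb 2 M⌋₊ := by
  rw [Nat.le_floor_iff (Real.logb_nonneg one_lt_two (by linarith)),
    Real.le_logb_iff_rpow_le one_lt_two (by linarith), Real.rpow_natCast]

/-- The sum equal to 1 has nonnegative terms, one of them 8(C + 1)pu²δ², and 8(C + 1) ≥ 8 · 17 =
136. -/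
theorem mul_sq_mul_sq_le_one {G C u : ℝ} (hp : 0 < p) (hG : 0 ≤ G) (hC : 16 ≤ C) (hu : 0 ≤ u)
    (h : p + p * (2 * (1 + G) * (1 + 4 * (C * u + (C + 1) * u ^ 2) * δ ^ 2)) = 1) :
    136 * (p * u ^ 2 * δ ^ 2) ≤ 1 := by
  have e : p * (2 * (1 + G) * (1 + 4 * (C * u + (C + 1) * u ^ 2) * δ ^ 2))
      = 136 * (p * u ^ 2 * δ ^ 2) + 8 * ((C - 16) * (p * u ^ 2 * δ ^ 2))
        + 8 * (p * (C * u * δ ^ 2)) + 2 * p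
        + p * (2 * G * (1 + 4 * (C * u + (C + 1) * u ^ 2) * δ ^ 2)) := by ring
  have hC0 : 0 < C := by linarith
  have e1 : 0 ≤ p * (2 * G * (1 + 4 * (C * u + (C + 1) * u ^ 2) * δ ^ 2)) := by positivity
  have e2 : 0 ≤ p * (C * u * δ ^ 2) := by positivity
  have e3 : 0 ≤ (C - 16) * (p * u ^ 2 * δ ^ 2) := mul_nonneg (by linarith) (by positivity)
  rw [e] at h
  generalize p * (2 * G * (1 + 4 * (C * u + (C + 1) * u ^ 2) * δ ^ 2)) = X at *
  generalize (C - 16) * (p * u ^ 2 * δ ^ 2) = Y at *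
  linarith

/-- The numerical inequalities satisfied by the parameters of the accelerated method. -/
theorem parameter_bounds (hL : 0 < L) (hγ : 0 < γ) (hγL : γ ≤ 3 / (4 * L)) (hb : 0 < b)
    (hβ0 : 0 < β)
    (hp : p = (1 + 2 * (1 + γ * L) *
      (1 + 4 * (constC1 * τ / b + (constC1 + 1) * τ ^ 2 / b ^ 2) * δ ^ 2))⁻¹)
    (hM : M = max 2 (Real.sqrt (constC2 * p⁻¹ * (1 + 2 * p / β))))
    (hB : B = ⌈(b : ℝ) * Real.logb 2 M⌉₊) :
    2 * (p * (1 + 2 * γ * L)) * (1 + (2 + 12 * ⌊Real.logb 2 M⌋₊) * (16 / 3 * τ / B) * δ ^ 2) ≤ 3 / 2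
    ∧ 2 * (p * (1 + 2 * γ * L)) * ((2 + 12 * ⌊Real.logb 2 M⌋₊) * (16 / 3 * τ / B))
        ≤ 400 * p * (τ / b)
    ∧ (4 + 2 * p / β) * (8 / 3 * τ / (2 ^ ⌊Real.logb 2 M⌋₊ * B)) ^ 2
        ≤ 4 / 3 * p * (τ ^ 2 / b ^ 2)
    ∧ 4 / 3 * p * (τ ^ 2 / b ^ 2) * δ ^ 2 ≤ 1 / 4 := by
  have hC1 := sixteen_le_constC1
  have hC1' := batch_const_le_constC1
  have hC0 : 0 < constC1 := by linarith
  have hb0 : (0 : ℝ) < b := Nat.cast_pos.2 hb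
  have hγL1 : γ * L ≤ 3 / 4 := by
    refine (mul_le_mul_of_nonneg_right hγL hL.le).trans (le_of_eq ?_)
    field_simp
  have hγL0 : 0 < γ * L := by positivity
  set u := (τ : ℝ) / b with hu
  have hu0 : 0 ≤ u := by positivity
  have hu2 : (τ : ℝ) ^ 2 / b ^ 2 = u ^ 2 := by rw [hu, div_pow]
  have hV : constC1 * τ / b + (constC1 + 1) * τ ^ 2 / b ^ 2 = constC1 * u + (constC1 + 1) * u ^ 2 := by
    rw [← hu2, hu]; ring
  rw [hV] at hp
  rw [hu2]
  have hden : 0 < 1 + 2 * (1 + γ * L) * (1 + 4 * (constC1 * u + (constC1 + 1) * u ^ 2) * δ ^ 2) := by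
    positivity
  have hp0 : 0 < p := by rw [hp]; positivity
  have hpeq : p + p * (2 * (1 + γ * L) * (1 + 4 * (constC1 * u + (constC1 + 1) * u ^ 2) * δ ^ 2))
      = 1 := by
    have : p * (1 + 2 * (1 + γ * L) * (1 + 4 * (constC1 * u + (constC1 + 1) * u ^ 2) * δ ^ 2)) = 1 := by
      rw [hp]; exact inv_mul_cancel₀ hden.ne'
    linarith
  have hM2 : 2 ≤ M := by rw [hM]; exact le_max_left _ _
  have hMsq : 256 / 3 * p⁻¹ * (1 + 2 * p / β) ≤ M ^ 2 := by
    have h1 : Real.sqrt (constC2 * p⁻¹ * (1 + 2 * p / β)) ≤ M := by rw [hM]; exact le_max_right _ _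
    exact (Real.sqrt_le_left (by linarith)).1 h1
  set ℓ := Real.logb 2 M with hℓ
  have hℓ1 : 1 ≤ ℓ := by
    rw [hℓ, Real.le_logb_iff_rpow_le one_lt_two (by linarith), Real.rpow_one]; exact hM2
  set K := ⌊ℓ⌋₊ with hKdef
  have hKℓ : (K : ℝ) ≤ ℓ := Nat.floor_le (by linarith)
  have hBℓ : b * ℓ ≤ B := by rw [hB]; exact Nat.le_ceil _
  have hbB : (b : ℝ) ≤ B := by nlinarith
  have hB0 : (0 : ℝ) < B := by linarith
  have hMK : M ≤ 2 * 2 ^ K := by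
    have h1 : ¬ (2 : ℝ) ^ (K + 1) ≤ M := by
      rw [two_pow_le_iff_le_floor_logb hM2, ← hℓ, ← hKdef]; omega
    rw [pow_succ] at h1
    linarith
  set V := (2 + 12 * (K : ℝ)) * (16 / 3 * τ / B) with hVdef
  have hV0 : 0 ≤ V := by positivity
  have hVle : V ≤ 224 / 3 * u := by
    -- The number of levels is absorbed here: K ≤ ℓ and 1 ≤ ℓ give 2 + 12K ≤ 14ℓ, while bℓ ≤ B.
    have h1 : (2 + 12 * (K : ℝ)) * b ≤ 14 * B := by nlinarith
    have h2 : (2 + 12 * (K : ℝ)) / B ≤ 14 / b := by rw [div_le_div_iff₀ hB0 hb0]; exact h1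
    calc V = (2 + 12 * (K : ℝ)) / B * (16 / 3 * τ) := by rw [hVdef]; ring
      _ ≤ 14 / b * (16 / 3 * τ) := mul_le_mul_of_nonneg_right h2 (by positivity)
      _ = _ := by rw [hu]; ring
  have hV' : V ≤ 4 * (constC1 * u + (constC1 + 1) * u ^ 2) := by
    have h1 := mul_le_mul_of_nonneg_right hC1' hu0
    have h2 : 0 ≤ 4 * ((constC1 + 1) * u ^ 2) := by positivity
    linarith
  refine ⟨?_, ?_, ?_, ?_⟩
  · have h1 : 1 + 2 * γ * L ≤ 3 / 2 * (1 + γ * L) := by linarith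
    have h2 : 1 + V * δ ^ 2 ≤ 1 + 4 * (constC1 * u + (constC1 + 1) * u ^ 2) * δ ^ 2 := by
      have := mul_le_mul_of_nonneg_right hV' (sq_nonneg δ)
      linarith
    calc 2 * (p * (1 + 2 * γ * L)) * (1 + V * δ ^ 2)
        ≤ 2 * (p * (3 / 2 * (1 + γ * L)))
          * (1 + 4 * (constC1 * u + (constC1 + 1) * u ^ 2) * δ ^ 2) := by gcongr
      _ ≤ 3 / 2 := by linarith
  · calc 2 * (p * (1 + 2 * γ * L)) * V ≤ 2 * (p * (5 / 2)) * (224 / 3 * u) := by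
          gcongr; linarith
      _ ≤ 400 * p * u := by
          have : 0 ≤ p * u := by positivity
          linarith
  · have hq0 : 0 < 2 * p / β := by positivity
    have h1 : 1 + 2 * p / β ≤ 3 / 256 * p * M ^ 2 := by
      have := mul_le_mul_of_nonneg_left hMsq (show 0 ≤ 3 / 256 * p by positivity)
      refine le_trans (le_of_eq ?_) this
      field_simp
    have h2 : 8 / 3 * τ / (2 ^ K * B) ≤ 16 / 3 * u / M := by
      rw [div_le_div_iff₀ (by positivity) (by linarith)]
      calc 8 / 3 * τ * M ≤ 8 / 3 * τ * (2 * 2 ^ K) := by gcongr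
        _ = 16 / 3 * u * (2 ^ K * b) := by rw [hu]; field_simp; ring
        _ ≤ 16 / 3 * u * (2 ^ K * B) := by gcongr
    have hM0 : 0 < M := by linarith
    -- The M² that controls the weight cancels the M⁻² of the squared bias, leaving 4 · (3/256) ·
    -- (16/3)² = 4/3.
    calc (4 + 2 * p / β) * (8 / 3 * τ / (2 ^ K * B)) ^ 2
        ≤ (4 * (3 / 256 * p * M ^ 2)) * (16 / 3 * u / M) ^ 2 := by
          gcongr
          linarith
      _ = 4 / 3 * p * u ^ 2 := by field_simp; ring
  · have h1 := mul_sq_mul_sq_le_one hp0 hγL0.le hC1 hu0 hpeq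
    have : 0 ≤ p * u ^ 2 * δ ^ 2 := by positivity
    linarith

end Parameters

/-! ### Conclusion -/

theorem mainTheorem1 :
    ∃ C : ℝ, 0 < C ∧
      ∀ (d : ℕ) (S Ω : Type*) [MeasurableSpace S] [MeasurableSpace Ω]
        (P : Measure Ω) [IsProbabilityMeasure P]
        (Q : Kernel S S) [IsMarkovKernel Q] (π : Measure S) (τ : ℕ)
        (Z : ℕ → Ω → S) (J : ℕ → Ω → ℕ)
        (F : EuclideanSpace ℝ (Fin d) → S → ℝ) (f : EuclideanSpace ℝ (Fin d) → ℝ)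
        (L μ σ δ : ℝ) (xs : EuclideanSpace ℝ (Fin d)),
        -- the objective `f(x) = 𝔼_{Z ∼ π} F(x, Z)` and its minimizer `xs`
        (∀ x, Measurable (F x)) →
        (∀ x, Integrable (F x) π) →
        (∀ z, Differentiable ℝ (fun x => F x z)) →
        (∀ x, f x = ∫ z, F x z ∂π) →
        IsLSmooth f L →
        IsStronglyConvex f μ →
        (∀ y, f xs ≤ f y) →
        -- the noise chain and the independent levels
        IsUniformlyGeometricallyErgodic Q π τ →
        IsMarkovChain Z Q π P →
        IsIIDGeometricHalf J P →
        IndepFun (fun ω k => J k ω) (fun ω n => Z n ω) P →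
        -- the stochastic gradient is unbiased and has bounded growth
        (∀ x, ∫ z, stochGrad F x z ∂π = gradient f x) →
        (∀ x z, ‖stochGrad F x z - gradient f x‖ ^ 2 ≤ σ ^ 2 + δ ^ 2 * ‖gradient f x‖ ^ 2) →
        ∀ (b : ℕ) (γ p β η θ M : ℝ) (B : ℕ) (x₀ : EuclideanSpace ℝ (Fin d)) (N : ℕ),
          0 < b →
          0 < γ →
          γ ≤ 3 / (4 * L) →
          p = (1 + 2 * (1 + γ * L) *
            (1 + 4 * (constC1 * τ / b + (constC1 + 1) * τ ^ 2 / b ^ 2) * δ ^ 2))⁻¹ →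
          β = Real.sqrt (4 * p ^ 2 * μ * γ / 3) →
          η = Real.sqrt (3 / (μ * γ)) →
          θ = (p * η⁻¹ - 1) / (β * p * η⁻¹ - 1) →
          M = max 2 (Real.sqrt (constC2 * p⁻¹ * (1 + 2 * p / β))) →
          B = ⌈(b : ℝ) * Real.logb 2 M⌉₊ →
          Integrable (fun ω =>
            ‖(accIterate F γ p β η θ M B x₀ (fun n => Z n ω) (fun k => J k ω) N).x - xs‖ ^ 2
              + 6 / μ *
                (f (accIterate F γ p β η θ M B x₀ (fun n => Z n ω) (fun k => J k ω) N).xf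
                  - f xs)) P ∧
          ∫ ω, (‖(accIterate F γ p β η θ M B x₀ (fun n => Z n ω) (fun k => J k ω) N).x - xs‖ ^ 2
              + 6 / μ *
                (f (accIterate F γ p β η θ M B x₀ (fun n => Z n ω) (fun k => J k ω) N).xf
                  - f xs)) ∂P
            ≤ C * (Real.exp (-(N * Real.sqrt (p ^ 2 * μ * γ / 3)))
                  * (‖x₀ - xs‖ ^ 2 + 6 / μ * (f x₀ - f xs))
                + p * Real.sqrt γ / μ ^ (3 / 2 : ℝ)
                  * (σ ^ 2 * τ / b + σ ^ 2 * τ ^ 2 / b ^ 2)) := by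
  -- 6 · 400 · 3/4 = 1800 from the noise term, doubled by β ≤ 2p√(μγ).
  refine ⟨3600, by norm_num, ?_⟩
  intro d S Ω _ _ P _ Q _ π τ Z J F f L μ σ δ xs hFm _ hFd _ hL hμ hxs hQ hZ hJ hJZ hunb hbnd
    b γ p β η θ M B x₀ N hb hγ hγL hp hβ hη hθ hM hB
  have hL0 := hL.pos
  have hμ0 := hμ.pos
  have hC1 := sixteen_le_constC1
  have hden : 0 < 2 * (1 + γ * L) *
      (1 + 4 * (constC1 * τ / b + (constC1 + 1) * τ ^ 2 / b ^ 2) * δ ^ 2) := by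
    have : 0 < constC1 := by linarith
    positivity
  have hp0 : 0 < p := by rw [hp]; positivity
  have hp1 : p ≤ 1 := by rw [hp]; exact inv_le_one_of_one_le₀ (by linarith)
  have hRHS : 0 ≤ p * Real.sqrt γ / μ ^ (3 / 2 : ℝ)
      * (σ ^ 2 * τ / b + σ ^ 2 * τ ^ 2 / b ^ 2) := by positivity
  have hΦ0 : 0 ≤ ‖x₀ - xs‖ ^ 2 + 6 / μ * (f x₀ - f xs) :=
    add_nonneg (by positivity) (mul_nonneg (by positivity) (sub_nonneg.2 (hxs _)))
  rcases subsingleton_or_nontrivial (EuclideanSpace ℝ (Fin d)) with hsub | hnt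
  -- In dimension zero μ ≤ L may fail, but the potential vanishes.
  · have hz : ∀ s : AccState d, ‖s.x - xs‖ ^ 2 + 6 / μ * (f s.xf - f xs) = 0 := fun s => by
      rw [Subsingleton.elim s.x xs, Subsingleton.elim s.xf xs]; simp
    simp only [hz]
    refine ⟨integrable_zero _ _ _, ?_⟩
    rw [integral_zero]
    positivity
  have hpar := isAccParam_of_eq hμ0 (hμ.le_of_isLSmooth hL) hγ hγL hp0 hp1 hβ hη hθ
  have hor : IsGradientOracle F f π σ δ :=
    ⟨measurable_uncurry_stochGrad hFm hFd, hL.differentiable.continuous, hL.continuous_gradient,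
      hunb, hbnd⟩
  have hJm : Measurable fun ω i => J i ω := measurable_pi_lambda _ hJ.measurable
  have hZm : Measurable fun ω i => Z i ω := measurable_pi_lambda _ hZ.measurable
  have := hZ.isProbabilityMeasure_pathLaw
  have : IsProbabilityMeasure (pathLaw J P) := Measure.isProbabilityMeasure_map hJm.aemeasurable
  have hmap : P.map (fun ω => ((fun i => J i ω), fun i => Z i ω))
      = (pathLaw J P).prod (pathLaw Z P) :=
    (indepFun_iff_map_prod_eq_prod_map_map hJm.aemeasurable hZm.aemeasurable).1 hJZ
  have hM2 : 2 ≤ M := by rw [hM]; exact le_max_left _ _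
  have hB0 : 0 < B := by
    rw [hB]
    refine Nat.ceil_pos.2 (mul_pos (Nat.cast_pos.2 hb) (Real.logb_pos one_lt_two (by linarith)))
  obtain ⟨ha, haV, hD, hDδ⟩ := parameter_bounds hL0 hγ hγL hb hpar.beta_pos hp hM hB
  have hrec := hor.integral_accPotential_succ_le (x₀ := x₀) hZ hQ hJ hL hμ hpar hxs hB0
    (two_pow_le_iff_le_floor_logb hM2) ha haV hD hDδ
  have hβ0 := hpar.beta_pos
  have hβ1 := hpar.beta_le
  have hfin := le_pow_mul_add_of_recursion (a := fun k => ∫ q, accPotential f μ xs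
    (accIterate F γ p β η θ M B x₀ q.2 q.1 k) ∂((pathLaw J P).prod (pathLaw Z P)))
    (show 0 < β / 2 by linarith) (by linarith) (by positivity) hrec N
  have hinit : ∫ q, accPotential f μ xs (accIterate F γ p β η θ M B x₀ q.2 q.1 0)
      ∂((pathLaw J P).prod (pathLaw Z P)) = ‖x₀ - xs‖ ^ 2 + 6 / μ * (f x₀ - f xs) := by
    simp [accIterate, accPotential]
  have hpm := hor.measurable_accPotential (μ := μ) (xs := xs) (γ := γ) (p := p) (β := β) (η := η)
    (θ := θ) (M := M) (B := B) (x₀ := x₀) N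
  have hpi := hor.integrable_accPotential (μ := μ) (xs := xs) (γ := γ) (p := p) (β := β) (η := η)
    (θ := θ) (M := M) (B := B) (x₀ := x₀) ((pathLaw J P).prod (pathLaw Z P)) N
  rw [← hmap] at hpi
  refine ⟨hpi.comp_measurable (hJm.prodMk hZm), ?_⟩
  have hlaw : ∫ q, accPotential f μ xs (accIterate F γ p β η θ M B x₀ q.2 q.1 N)
        ∂((pathLaw J P).prod (pathLaw Z P))
      = ∫ ω, accPotential f μ xs (accIterate F γ p β η θ M B x₀ (fun n => Z n ω)
        (fun k => J k ω) N) ∂P := by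
    rw [← hmap, integral_map (hJm.prodMk hZm).aemeasurable hpm.aestronglyMeasurable]
  simp only [hlaw, hinit] at hfin
  change ∫ ω, accPotential f μ xs (accIterate F γ p β η θ M B x₀ (fun n => Z n ω)
        (fun k => J k ω) N) ∂P ≤ _
  refine hfin.trans ?_
  have hrate : Real.sqrt (p ^ 2 * μ * γ / 3) = β / 2 := by
    rw [Real.sqrt_eq_iff_mul_self_eq (by positivity) (by positivity)]
    have h1 : β ^ 2 = 4 * p ^ 2 * μ * γ / 3 := by rw [hβ]; exact Real.sq_sqrt (by positivity)
    linarith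
  have hexp : (1 - β / 2) ^ N ≤ Real.exp (-(N * Real.sqrt (p ^ 2 * μ * γ / 3))) := by
    rw [hrate, show -((N : ℝ) * (β / 2)) = N * -(β / 2) by ring, Real.exp_nat_mul]
    refine pow_le_pow_left₀ (by linarith) ?_ N
    have := Real.add_one_le_exp (-(β / 2))
    linarith
  have hnoise : 3 * p * γ / μ * (400 * p * (τ / b) + 4 / 3 * p * (τ ^ 2 / b ^ 2)) * σ ^ 2 / (β / 2)
      ≤ 3600 * (p * Real.sqrt γ / μ ^ (3 / 2 : ℝ) * (σ ^ 2 * τ / b + σ ^ 2 * τ ^ 2 / b ^ 2)) := by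
    have h32 : μ ^ (3 / 2 : ℝ) = μ * Real.sqrt μ := by
      rw [show (3 / 2 : ℝ) = 1 + 1 / 2 by norm_num, Real.rpow_add hμ0, Real.rpow_one,
        ← Real.sqrt_eq_rpow]
    have hβle : β ≤ 2 * p * (Real.sqrt μ * Real.sqrt γ) := by
      rw [hβ]
      refine Real.sqrt_le_iff.2 ⟨by positivity, ?_⟩
      rw [mul_pow, mul_pow (Real.sqrt μ), Real.sq_sqrt hμ0.le, Real.sq_sqrt hγ.le]
      have : 0 ≤ p ^ 2 * μ * γ := by positivity
      linarith
    have hsμ : 0 < Real.sqrt μ := Real.sqrt_pos.2 hμ0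
    have hβμ : β / μ ^ 2 ≤ 2 * (p * Real.sqrt γ / μ ^ (3 / 2 : ℝ)) := by
      rw [h32, div_le_iff₀ (by positivity)]
      refine hβle.trans (le_of_eq ?_)
      have hs : Real.sqrt μ * Real.sqrt μ = μ := Real.mul_self_sqrt hμ0.le
      rw [show μ ^ 2 = μ * (Real.sqrt μ * Real.sqrt μ) by rw [hs]; ring]
      field_simp
    have hS : 0 ≤ σ ^ 2 * τ / b + σ ^ 2 * τ ^ 2 / b ^ 2 := by positivity
    have hS1 : (400 * p * (τ / b) + 4 / 3 * p * (τ ^ 2 / b ^ 2)) * σ ^ 2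
        ≤ 400 * p * (σ ^ 2 * τ / b + σ ^ 2 * τ ^ 2 / b ^ 2) := by
      have : 0 ≤ p * (σ ^ 2 * τ ^ 2 / b ^ 2) := by positivity
      have e : (400 * p * (τ / b) + 4 / 3 * p * (τ ^ 2 / b ^ 2)) * σ ^ 2
          = 400 * p * (σ ^ 2 * τ / b) + 4 / 3 * (p * (σ ^ 2 * τ ^ 2 / b ^ 2)) := by ring
      rw [e]; linarith
    calc 3 * p * γ / μ * (400 * p * (τ / b) + 4 / 3 * p * (τ ^ 2 / b ^ 2)) * σ ^ 2 / (β / 2)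
        = 6 * p * γ / (μ * β)
          * ((400 * p * (τ / b) + 4 / 3 * p * (τ ^ 2 / b ^ 2)) * σ ^ 2) := by
          field_simp; ring
      _ ≤ 6 * p * γ / (μ * β) * (400 * p * (σ ^ 2 * τ / b + σ ^ 2 * τ ^ 2 / b ^ 2)) :=
          mul_le_mul_of_nonneg_left hS1 (by positivity)
      _ = 2400 / (μ * β) * (p ^ 2 * γ) * (σ ^ 2 * τ / b + σ ^ 2 * τ ^ 2 / b ^ 2) := by ring
      _ = 1800 * (β / μ ^ 2) * (σ ^ 2 * τ / b + σ ^ 2 * τ ^ 2 / b ^ 2) := by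
          rw [hpar.sq_eq]; congr 1; field_simp; ring
      _ ≤ 1800 * (2 * (p * Real.sqrt γ / μ ^ (3 / 2 : ℝ)))
          * (σ ^ 2 * τ / b + σ ^ 2 * τ ^ 2 / b ^ 2) := by gcongr
      _ = _ := by ring
  have h1 := mul_le_mul_of_nonneg_right hexp hΦ0
  have h2 : 0 ≤ Real.exp (-(N * Real.sqrt (p ^ 2 * μ * γ / 3)))
      * (‖x₀ - xs‖ ^ 2 + 6 / μ * (f x₀ - f xs)) := mul_nonneg (Real.exp_pos _).le hΦ0
  linarith
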